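/- **Theorem 5.1 (group size power-law).** Fix $0<\alpha<1$, $0<\eta<1$, $0<r\le 1/2$, $0\le\xi\le 1$ and $\rho^{(p)}_R,\rho^{(p)}_B,\rho^{(u)}_R,\rho^{(u)}_B\in[0,1]$. The generalized selective homophily model (GSHM) is the following random growing bipartite network of members and groups, each colored red ($R$) or blue ($B$); degrees are counted with multiplicity, and the size of a group is its degree. At time $t=2$ there are one red member connected to a red group and one blue member connected to a blue group. In every later time step: * with probability $\alpha$ a new member $m^*$ arrives, red with probability $r$ and blue otherwise; with probability $1-\alpha$ an existing member $m^*$ is chosen with probability proportional to its degree; * with probability $\eta$ the member $m^*$ creates, and is connected to, a new group of its own color $c(m^*)$; * otherwise $m^*$ joins an existing group as follows: with probability $\xi$ a group $g^*$ is picked with probability proportional to its size, and with probability $1-\xi$ uniformly at random. If $c(g^*)=c(m^*)$, then $m^*$ joins $g^*$; otherwise $m^*$ accepts with probability $\rho^{(p)}_{c(m^*)}$ if $g^*$ was picked proportionally to size, and with probability $\rho^{(u)}_{c(m^*)}$ if it was picked uniformly. If $m^*$ does not accept, this whole joining procedure (including the choice between the two ways of picking) restarts, until a connection is made. Let $G_{k,t}(C)$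 be the number of groups of color $C$ and size $k$ at time $t$, and $E^{(G)}_t(C)$ the sum of the sizes of the groups of color $C$ at time $t$. Put $$D_R(x)=1-(1-\rho^{(p)}_R)\xi(1-x)-(1-\rho^{(u)}_R)(1-\xi)(1-r),\qquad D_B(x)=1-(1-\rho^{(p)}_B)\xi x-(1-\rho^{(u)}_B)(1-\xi)r,$$ $$F(x)=r\eta+\frac{r(1-\eta)\bigl(\xi x+(1-\xi)r\bigr)}{D_R(x)}+\frac{(1-r)(1-\eta)\bigl(\rho^{(p)}_B\xi x+\rho^{(u)}_B(1-\xi)r\bigr)}{D_B(x)}.$$ Assume $\rho^{(p)}_R,\rho^{(p)}_B>0$. Then $F$ has exactly one fixed point $\alpha^*$ in $(0,1)$, and almost surely $$\lim_{t\to\infty}\frac{E^{(G)}_t(R)}{E^{(G)}_t(R)+E^{(G)}_t(B)}=\alpha^*.$$ With $$C_{R,1}=\frac{r(1-\eta)\xi}{D_R(\alpha^*)}+\frac{(1-r)(1-\eta)\rho^{(p)}_B\xi}{D_B(\alpha^*)},\qquad C_{B,1}=\frac{(1-r)(1-\eta)\xi}{D_B(\alpha^*)}+\frac{r(1-\eta)\rho^{(p)}_R\xi}{D_R(\alpha^*)},$$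 $$C_{R,2}=\frac{r(1-\eta)(1-\xi)\frac1\eta}{D_R(\alpha^*)}+\frac{(1-r)(1-\eta)\rho^{(u)}_B(1-\xi)\frac1\eta}{D_B(\alpha^*)},\qquad C_{B,2}=\frac{(1-r)(1-\eta)(1-\xi)\frac1\eta}{D_B(\alpha^*)}+\frac{r(1-\eta)\rho^{(u)}_R(1-\xi)\frac1\eta}{D_R(\alpha^*)},$$ the limits $G_k(C)=\lim_{t\to\infty}\mathbb E\bigl(G_{k,t}(C)\bigr)/t$ exist for $C\in\{R,B\}$ and all $k\ge1$, and they satisfy $$G_1(R)=\frac{r\eta}{1+C_{R,1}+C_{R,2}},\qquad G_1(B)=\frac{(1-r)\eta}{1+C_{B,1}+C_{B,2}},\qquad G_k(C)=G_{k-1}(C)\,\frac{(k-1)C_{C,1}+C_{C,2}}{1+kC_{C,1}+C_{C,2}}\quad(k\ge2).$$ If moreover $\xi>0$, then $C_{R,1},C_{B,1}>0$, and both distributions follow power laws with exponents $\beta(R)=1+\frac1{C_{R,1}}$ and $\beta(B)=1+\frac1{C_{B,1}}$: for each $C\in\{R,B\}$ there is a constant $A_C>0$ with $G_k(C)\sim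 A_C\,k^{-\beta(C)}$ as $k\to\infty$. -/

import Mathlib

open Filter Topology MeasureTheory ProbabilityTheory Asymptotics
open scoped ENNReal

namespace GSHM

/-- The two affiliations; red is the minority. -/
inductive Color where
  | red
  | blue
  deriving DecidableEq

/-- The parameters `Θ` of the model. `rhoP c` and `rhoU c` are the probabilities with which a member
of color `c` accepts a group of the other color, when the group was proposed by the rich-get-richer
and by the equal-chance mechanism, respectively. -/
structure Params where
  alpha : ℝ
  eta : ℝ
  r : ℝ
  xi : ℝ
  rhoP : Color → ℝ
  rhoU : Color → ℝ
  alpha_pos : 0 < alpha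
  alpha_lt_one : alpha < 1
  eta_pos : 0 < eta
  eta_lt_one : eta < 1
  r_pos : 0 < r
  r_le_half : r ≤ 1 / 2
  xi_nonneg : 0 ≤ xi
  xi_le_one : xi ≤ 1
  rhoP_nonneg : ∀ c, 0 ≤ rhoP c
  rhoP_le_one : ∀ c, rhoP c ≤ 1
  rhoU_nonneg : ∀ c, 0 ≤ rhoU c
  rhoU_le_one : ∀ c, rhoU c ≤ 1

/-- A finite bi-affiliated bipartite (multi)network. The members are `0, …, members.length - 1`, the
groups are `0, …, groups.length - 1` (both in order of arrival), the two lists hold their colors,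
and every entry `(m, g)` of `edges` is a connection between member `m` and group `g`. -/
structure Network where
  members : List Color
  groups : List Color
  edges : List (ℕ × ℕ)

instance : MeasurableSpace Network := ⊤

namespace Network

/-- The color of member `m` (the default `red` is never used for an existing member). -/
def memberColor (N : Network) (m : ℕ) : Color := N.members.getD m Color.red

/-- The color of group `g` (the default `red` is never used for an existing group). -/
def groupColor (N : Network) (g : ℕ) : Color := N.groups.getD g Color.red

/-- The degree of member `m`. -/
def memberDegree (N : Network) (m : ℕ) : ℕ := N.edges.countP (fun e => e.1 = m)

/-- The size (degree) of group `g`. -/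
def groupSize (N : Network) (g : ℕ) : ℕ := N.edges.countP (fun e => e.2 = g)

/-- The number of groups of color `c` and size `k`. -/
def sizeCount (N : Network) (c : Color) (k : ℕ) : ℕ :=
  ((Finset.range N.groups.length).filter (fun g => N.groupColor g = c ∧ N.groupSize g = k)).card

/-- The sum of the sizes of the groups of color `c`. -/
def sizeSum (N : Network) (c : Color) : ℕ :=
  ∑ g ∈ (Finset.range N.groups.length).filter (fun g => N.groupColor g = c), N.groupSize g

/-- One red member connected to a red group, one blue member connected to a blue group. -/
def initial : Network where
  members := [Color.red, Color.blue]
  groups := [Color.red, Color.blue]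
  edges := [(0, 0), (1, 1)]

/-- A new, still unconnected, member of color `c`; its index is `N.members.length`. -/
def addMember (N : Network) (c : Color) : Network :=
  { N with members := N.members ++ [c] }

/-- A new connection between member `m` and group `g`. -/
def connect (N : Network) (m g : ℕ) : Network :=
  { N with edges := (m, g) :: N.edges }

/-- Member `m` creates a group of its own color and is connected to it. -/
def createGroup (N : Network) (m : ℕ) : Network :=
  connect { N with groups := N.groups ++ [N.memberColor m] } m N.groups.length

end Network

noncomputable section

/-- A coin that shows `true` with probability `p`. -/
def coin (p : ℝ) (h0 : 0 ≤ p) (h1 : p ≤ 1) : PMF Bool :=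
  PMF.ofFintype (fun b => ENNReal.ofReal (if b then p else 1 - p)) (by
    rw [Fintype.sum_bool]
    simp only [if_true, Bool.false_eq_true, if_false]
    rw [← ENNReal.ofReal_add h0 (by linarith)]
    simp)

/-- The weight function behind `pick`: `w i` for `i < n`, zero beyond. -/
def pickWeight (n : ℕ) (w : ℕ → ℕ) (i : ℕ) : ℝ≥0∞ := if i < n then (w i : ℝ≥0∞) else 0

theorem tsum_pickWeight (n : ℕ) (w : ℕ → ℕ) :
    ∑' i, pickWeight n w i = ((∑ i ∈ Finset.range n, w i : ℕ) : ℝ≥0∞) := by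
  rw [tsum_eq_sum (s := Finset.range n) (fun i hi => by
    simp only [Finset.mem_range] at hi
    simp [pickWeight, hi]), Nat.cast_sum]
  exact Finset.sum_congr rfl fun i hi => by simp [pickWeight, Finset.mem_range.mp hi]

/-- A random element of `{0, …, n - 1}` with probability proportional to `w`. (If all the weights
vanish, which never happens in the model, the value is irrelevant.) -/
def pick (n : ℕ) (w : ℕ → ℕ) : PMF ℕ :=
  open Classical in
  if h : ∑ i ∈ Finset.range n, w i ≠ 0 then
    PMF.normalize (pickWeight n w)
      (by rw [tsum_pickWeight]; exact_mod_cast h)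
      (by rw [tsum_pickWeight]; exact ENNReal.natCast_ne_top _)
  else PMF.pure 0

theorem tsum_some (a : PMF (Option ℕ)) : ∑' g, a (some g) = 1 - a none := by
  have h := a.tsum_coe
  rw [ENNReal.tsum_eq_add_tsum_ite none] at h
  have h2 : ∑' g : ℕ, (fun o : Option ℕ => if o = none then 0 else a o) (some g) =
      ∑' o : Option ℕ, if o = none then 0 else a o :=
    (Option.some_injective ℕ).tsum_eq (f := fun o : Option ℕ => if o = none then 0 else a o)
      (fun o ho => by cases o <;> simp_all)
  simp only [reduceCtorEq, if_false] at h2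
  rw [h2, ← h, ENNReal.add_sub_cancel_left (a.apply_ne_top none)]
  exact tsum_congr fun o => by congr

theorem tsum_repeat (a : PMF (Option ℕ)) (h : a none ≠ 1) :
    ∑' g, ∑' n : ℕ, a none ^ n * a (some g) = 1 := by
  have hlt : a none < 1 := lt_of_le_of_ne (a.coe_le_one none) h
  simp_rw [ENNReal.tsum_mul_right, ENNReal.tsum_mul_left, ENNReal.tsum_geometric, tsum_some]
  exact ENNReal.inv_mul_cancel (tsub_pos_of_lt hlt).ne' (by simp)

/-- Independent repetitions of the attempt `a` (where `none` is a failure) until the first success: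
the result is `g` if, for some `n`, the first `n` attempts fail and the next one gives `g`.
(If success is impossible, which never happens in the model, the value is irrelevant.) -/
def untilSuccess (a : PMF (Option ℕ)) : PMF ℕ :=
  open Classical in
  if h : a none ≠ 1 then
    ⟨fun g => ∑' n : ℕ, a none ^ n * a (some g), by
      rw [← tsum_repeat a h]; exact ENNReal.summable.hasSum⟩
  else PMF.pure 0

/-- A member of color `c` considers group `g`: it joins if the colors agree, and otherwise accepts
with probability `p`. -/
def consider (N : Network) (c : Color) (g : ℕ) (p : ℝ) (h0 : 0 ≤ p) (h1 : p ≤ 1) :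
    PMF (Option ℕ) :=
  if N.groupColor g = c then PMF.pure (some g)
  else (coin p h0 h1).map (fun accept => if accept then some g else none)

/-- One pass through the connection growth step, for a member of color `c`; `none` means that the
connection was not accepted. -/
def attempt (Θ : Params) (N : Network) (c : Color) : PMF (Option ℕ) :=
  (coin Θ.xi Θ.xi_nonneg Θ.xi_le_one).bind fun rich =>
    if rich then
      (pick N.groups.length N.groupSize).bind fun g =>
        consider N c g (Θ.rhoP c) (Θ.rhoP_nonneg c) (Θ.rhoP_le_one c)
    else
      (pick N.groups.length (fun _ => 1)).bind fun g =>
        consider N c g (Θ.rhoU c) (Θ.rhoU_nonneg c) (Θ.rhoU_le_one c)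

/-- Group growth (member `m` creates a group) or connection growth (it joins an existing group). -/
def groupStep (Θ : Params) (N : Network) (m : ℕ) : PMF Network :=
  (coin Θ.eta Θ.eta_pos.le Θ.eta_lt_one.le).bind fun create =>
    if create then PMF.pure (N.createGroup m)
    else (untilSuccess (attempt Θ N (N.memberColor m))).map (fun g => N.connect m g)

/-- One time step: member growth, followed by group growth or connection growth. -/
def step (Θ : Params) (N : Network) : PMF Network :=
  (coin Θ.alpha Θ.alpha_pos.le Θ.alpha_lt_one.le).bind fun new =>
    if new then
      (coin Θ.r Θ.r_pos.le (Θ.r_le_half.trans (by norm_num))).bind fun isRed =>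
        groupStep Θ (N.addMember (if isRed then Color.red else Color.blue)) N.members.length
    else
      (pick N.members.length N.memberDegree).bind fun m => groupStep Θ N m

/-- `N t` (for `t = 2, 3, …`) is the network at time `t` of the generalized selective homophily
model: a Markov chain that starts at time `2` in the initial network and has the transition
probabilities `step Θ`. The values `N 0` and `N 1` play no role. -/
structure IsGSHM (Θ : Params) {Ω : Type*} [MeasurableSpace Ω] (P : Measure Ω)
    (N : ℕ → Ω → Network) : Prop where
  measurable : ∀ t, 2 ≤ t → Measurable (N t)
  start : ∀ᵐ ω ∂P, N 2 ω = Network.initial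
  markov : ∀ t, 2 ≤ t → ∀ x : ℕ → Network,
    P {ω | ∀ i, 2 ≤ i → i ≤ t + 1 → N i ω = x i} =
      P {ω | ∀ i, 2 ≤ i → i ≤ t → N i ω = x i} * step Θ (x t) (x (t + 1))

namespace Params

/-- The denominator that belongs to red members. -/
def denomRed (Θ : Params) (x : ℝ) : ℝ :=
  1 - (1 - Θ.rhoP .red) * Θ.xi * (1 - x) - (1 - Θ.rhoU .red) * (1 - Θ.xi) * (1 - Θ.r)

/-- The denominator that belongs to blue members. -/
def denomBlue (Θ : Params) (x : ℝ) : ℝ :=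
  1 - (1 - Θ.rhoP .blue) * Θ.xi * x - (1 - Θ.rhoU .blue) * (1 - Θ.xi) * Θ.r

/-- The rational map whose fixed point is `α*`. -/
def shareMap (Θ : Params) (x : ℝ) : ℝ :=
  Θ.r * Θ.eta
    + Θ.r * (1 - Θ.eta) * (Θ.xi * x + (1 - Θ.xi) * Θ.r) / Θ.denomRed x
    + (1 - Θ.r) * (1 - Θ.eta) * (Θ.rhoP .blue * Θ.xi * x + Θ.rhoU .blue * (1 - Θ.xi) * Θ.r)
        / Θ.denomBlue x

/-- The constants `C_{R,1}` and `C_{B,1}`, as functions of the value `a` of `α*`. -/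
def C1 (Θ : Params) (a : ℝ) : Color → ℝ
  | .red =>
      Θ.r * (1 - Θ.eta) * Θ.xi / Θ.denomRed a
        + (1 - Θ.r) * (1 - Θ.eta) * Θ.rhoP .blue * Θ.xi / Θ.denomBlue a
  | .blue =>
      (1 - Θ.r) * (1 - Θ.eta) * Θ.xi / Θ.denomBlue a
        + Θ.r * (1 - Θ.eta) * Θ.rhoP .red * Θ.xi / Θ.denomRed a

/-- The constants `C_{R,2}` and `C_{B,2}`, as functions of the value `a` of `α*`. -/
def C2 (Θ : Params) (a : ℝ) : Color → ℝ
  | .red =>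
      Θ.r * (1 - Θ.eta) * (1 - Θ.xi) * (1 / Θ.eta) / Θ.denomRed a
        + (1 - Θ.r) * (1 - Θ.eta) * Θ.rhoU .blue * (1 - Θ.xi) * (1 / Θ.eta) / Θ.denomBlue a
  | .blue =>
      (1 - Θ.r) * (1 - Θ.eta) * (1 - Θ.xi) * (1 / Θ.eta) / Θ.denomBlue a
        + Θ.r * (1 - Θ.eta) * Θ.rhoU .red * (1 - Θ.xi) * (1 / Θ.eta) / Θ.denomRed a

/-- The probability that a new member has color `c`. -/
def colorProb (Θ : Params) : Color → ℝ
  | .red => Θ.r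
  | .blue => 1 - Θ.r

/-- The exponents `β(R)` and `β(B)`, as functions of the value `a` of `α*`. -/
def beta (Θ : Params) (a : ℝ) (c : Color) : ℝ := 1 + 1 / Θ.C1 a c

end Params

end

end GSHM

/-!
All statistics of the network that matter change by at most `1` in a time step, and divided by the
time `t` each of them is a stochastic approximation: `x = v / t` moves by `1 / (t + 1)` times
`f x - x` plus a vanishing error plus a martingale difference. The weighted martingale differences
are summable almost surely (`ae_exists_tendsto_sum_mul_of_condExp_eq_zero`), so `x` converges to the
point `a` at which the graph of `f` crosses the diagonal downwards (`tendsto_ratio_of_drift`,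
`IsGSHM.ae_tendsto_div`). This is applied successively to four kinds of statistics, each using the
limits of the previous ones.

* The degrees of the members of color `c` sum up to `r t` or `(1 - r) t` asymptotically, so the
  member `m*` has color `c` with probability tending to `colorProb c`.
* The numbers of groups of the two colors are then asymptotically `η r t` and `η (1 - r) t`.
* The share of the red groups in the total of the sizes has asymptotic drift `shareMap x - x`. After
  multiplication by the denominators this is a cubic with nonnegative leading coefficient, positive
  at `0` and negative at `1`, so that there is one fixed point in `(0, 1)`, and it is attracting
  (`exists_shareMap_fixedPoint`).
* A given group of color `c` and size `k` gains a connection with probability asymptotically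
  `(k * C1 + C2) / t`. Hence the number of such groups has an affine drift, whose zero is
  `limitCount`, by induction on `k`. Bounded convergence passes to the expectations.

The conditional mean increments come from an exact formula for one step (`expect_step`) and the
Markov property (`IsGSHM.condExp_eq`). The recursion for `limitCount` is a quotient of rising
factorials, whence the power law (`exists_isEquivalent_rpow_of_recursion`). Time is shifted by two
throughout: index `n` stands for time `n + 2`, at which there are `n + 2` connections.
-/

namespace GSHM

/-! ### Stochastic approximation -/

/-- One half of the convergence of a stochastic approximation with step sizes `γ` and noise
`W (n + 1) - W n`. As the noise is summable, `y n = x n + (w - W n)` has the same limit behavior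
as `x` and moves only by `γ n * b n`; where `x` is above `a`, this drift is downwards and bounded
away from `0`. -/
theorem eventually_le_of_drift {x γ b W : ℕ → ℝ} {w a C : ℝ}
    (hx : ∀ n, x (n + 1) = x n + γ n * b n + (W (n + 1) - W n))
    (hW : Tendsto W atTop (𝓝 w)) (hγ0 : ∀ n, 0 ≤ γ n) (hγ : Tendsto γ atTop (𝓝 0))
    (hγs : Tendsto (fun n => ∑ i ∈ Finset.range n, γ i) atTop atTop)
    (hC : ∀ᶠ n in atTop, b n ≤ C)
    (hb : ∀ δ > 0, ∃ c > 0, ∀ᶠ n in atTop, a + δ ≤ x n → b n ≤ -c) {ε : ℝ} (hε : 0 < ε) :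
    ∀ᶠ n in atTop, x n ≤ a + ε := by
  obtain ⟨δ, hδ, rfl⟩ : ∃ δ > 0, ε = 4 * δ := ⟨ε / 4, by positivity, by ring⟩
  obtain ⟨c, hc, hbc⟩ := hb δ hδ
  have hγC : Tendsto (fun n => γ n * C) atTop (𝓝 0) := by simpa using hγ.mul_const C
  have hWw : Tendsto (fun n => w - W n) atTop (𝓝 0) := by simpa using hW.const_sub w
  obtain ⟨T, hT⟩ := eventually_atTop.1 (hC.and (hbc.and ((hγC.eventually_le_const hδ).and
    ((hWw.eventually_le_const hδ).and (hWw.eventually_const_le (neg_lt_zero.2 hδ))))))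
  set y : ℕ → ℝ := fun n => x n + (w - W n) with hy
  have hyn : ∀ n, y (n + 1) = y n + γ n * b n := fun n => by simp only [hy, hx n]; ring
  have hdec : ∀ n ≥ T, a + 2 * δ ≤ y n → y (n + 1) ≤ y n - c * γ n := by
    intro n hn h
    obtain ⟨-, h2, -, h4, -⟩ := hT n hn
    have := h2 (by simp only [hy] at h; linarith)
    rw [hyn]
    nlinarith [hγ0 n]
  have hlow : ∀ n ≥ T, y n ≤ a + 3 * δ → y (n + 1) ≤ a + 3 * δ := by
    intro n hn h
    rcases le_total (a + 2 * δ) (y n) with h' | h'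
    · have := hdec n hn h'
      nlinarith [hγ0 n]
    · obtain ⟨h1, -, h3, -, -⟩ := hT n hn
      rw [hyn]
      nlinarith [hγ0 n]
  -- the divergence of the sum of the step sizes forces the sequence below the barrier
  have hex : ∃ t ≥ T, y t ≤ a + 3 * δ := by
    by_contra! hcon
    have hle : ∀ n ≥ T, y n + c * ∑ i ∈ Finset.range n, γ i
        ≤ y T + c * ∑ i ∈ Finset.range T, γ i := by
      intro n hn
      induction n, hn using Nat.le_induction with
      | base => exact le_rfl
      | succ n hn ih =>
        have := hdec n hn (by linarith [hcon n hn])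
        rw [Finset.sum_range_succ]
        linarith
    have hlim := hγs.const_mul_atTop hc
    obtain ⟨n, hn, hn'⟩ := ((hlim.eventually_gt_atTop
      (y T + c * ∑ i ∈ Finset.range T, γ i - (a + 3 * δ))).and (eventually_ge_atTop T)).exists
    linarith [hle n hn', hcon n hn']
  obtain ⟨t, htT, ht⟩ := hex
  filter_upwards [eventually_ge_atTop t] with n hn
  have hyle : y n ≤ a + 3 * δ := by
    induction n, hn using Nat.le_induction with
    | base => exact ht
    | succ n hn ih => exact hlow n (htT.trans hn) ih
  have := (hT n (htT.trans hn)).2.2.2.2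
  simp only [hy] at hyle
  linarith

/-- Convergence of a stochastic approximation whose drift points towards `a`. -/
theorem tendsto_of_drift {x γ b W : ℕ → ℝ} {w a C : ℝ}
    (hx : ∀ n, x (n + 1) = x n + γ n * b n + (W (n + 1) - W n))
    (hW : Tendsto W atTop (𝓝 w)) (hγ0 : ∀ n, 0 ≤ γ n) (hγ : Tendsto γ atTop (𝓝 0))
    (hγs : Tendsto (fun n => ∑ i ∈ Finset.range n, γ i) atTop atTop)
    (hC : ∀ᶠ n in atTop, |b n| ≤ C)
    (hb : ∀ δ > 0, ∃ c > 0, ∀ᶠ n in atTop, a + δ ≤ x n → b n ≤ -c)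
    (hb' : ∀ δ > 0, ∃ c > 0, ∀ᶠ n in atTop, x n ≤ a - δ → c ≤ b n) :
    Tendsto x atTop (𝓝 a) := by
  have hup := fun ε (hε : ε > 0) => eventually_le_of_drift hx hW hγ0 hγ hγs
    (hC.mono fun n hn => (abs_le.1 hn).2) hb hε
  have hdown : ∀ ε > 0, ∀ᶠ n in atTop, -x n ≤ -a + ε := fun ε hε =>
    eventually_le_of_drift (x := fun n => -x n) (b := fun n => -b n) (W := fun n => -W n)
      (C := C) (fun n => by rw [hx n]; ring) hW.neg hγ0 hγ hγs
      (hC.mono fun n hn => by linarith [(abs_le.1 hn).1])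
      (fun δ hδ => by
        obtain ⟨c, hc, h⟩ := hb' δ hδ
        exact ⟨c, hc, h.mono fun n hn hn' => by linarith [hn (by linarith)]⟩) hε
  refine Metric.tendsto_atTop'.2 fun ε hε => ?_
  obtain ⟨n, hn⟩ := eventually_atTop.1 ((hup (ε / 2) (by positivity)).and
    (hdown (ε / 2) (by positivity)))
  refine ⟨n, fun m hm => ?_⟩
  obtain ⟨h1, h2⟩ := hn m hm.le
  rw [Real.dist_eq, abs_lt]
  constructor <;> linarith

theorem exists_forall_le_neg_of_isCompact {K : Set ℝ} (hK : IsCompact K) {g : ℝ → ℝ}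
    (hg : ContinuousOn g K) (hneg : ∀ x ∈ K, g x < 0) : ∃ c > 0, ∀ x ∈ K, g x ≤ -c := by
  rcases K.eq_empty_or_nonempty with rfl | hne
  · exact ⟨1, one_pos, by simp⟩
  · obtain ⟨z, hz, hmax⟩ := hK.exists_isMaxOn hne hg
    exact ⟨-g z, by linarith [hneg z hz], fun x hx => by simpa using hmax hx⟩

theorem tendsto_sum_range_one_div_add_three :
    Tendsto (fun n => ∑ i ∈ Finset.range n, 1 / ((i : ℝ) + 3)) atTop atTop := by
  have h := Real.tendsto_sum_range_one_div_nat_succ_atTop.comp (tendsto_add_atTop_nat 2)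
  have h2 := tendsto_atTop_add_const_right _ (-(1 + 1 / 2 : ℝ)) h
  refine h2.congr fun n => ?_
  simp only [Function.comp]
  rw [add_comm n 2, Finset.sum_range_add]
  norm_num [Finset.sum_range_succ]
  refine Finset.sum_congr rfl fun i _ => ?_
  ring_nf

/-- Let `V` have conditional mean increments `d n`, which are asymptotically `f (V n / (n + 2))`,
and summable noise. If the graph of `f` lies above the diagonal to the left of `a` and below it to
the right, then `V n / (n + 2)` tends to `a`. (The index `n` stands for time `n + 2`.) -/
theorem tendsto_ratio_of_drift {V d ξ : ℕ → ℝ} {f : ℝ → ℝ} {w a : ℝ}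
    (hV : ∀ n, V (n + 1) = V n + d n + ξ n) (hV0 : ∀ n, 0 ≤ V n) (hV1 : ∀ n, V n ≤ n + 2)
    (hξ : Tendsto (fun n => ∑ i ∈ Finset.range n, 1 / ((i : ℝ) + 3) * ξ i) atTop (𝓝 w))
    (hf : ContinuousOn f (Set.Icc 0 1))
    (hd : Tendsto (fun n => d n - f (V n / (n + 2))) atTop (𝓝 0))
    (hlt : ∀ x ∈ Set.Icc (0 : ℝ) 1, x < a → x < f x)
    (hgt : ∀ x ∈ Set.Icc (0 : ℝ) 1, a < x → f x < x) :
    Tendsto (fun n => V n / (n + 2)) atTop (𝓝 a) := by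
  have hmem : ∀ n, V n / (n + 2) ∈ Set.Icc (0 : ℝ) 1 := fun n =>
    ⟨div_nonneg (hV0 n) (by positivity), (div_le_one (by positivity)).2 (hV1 n)⟩
  have hg : ContinuousOn (fun x => f x - x) (Set.Icc 0 1) := hf.sub continuousOn_id
  obtain ⟨C, hC⟩ := isCompact_Icc.exists_bound_of_continuousOn hg
  refine tendsto_of_drift (γ := fun n => 1 / ((n : ℝ) + 3))
    (b := fun n => d n - V n / (n + 2)) 
    (W := fun n => ∑ i ∈ Finset.range n, 1 / ((i : ℝ) + 3) * ξ i) (C := C + 1)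
    (fun n => ?_) hξ (fun n => by positivity) ?_
    tendsto_sum_range_one_div_add_three ?_ (fun δ hδ => ?_) (fun δ hδ => ?_)
  · rw [hV, Finset.sum_range_succ]
    push_cast
    field_simp
    ring
  · exact (tendsto_one_div_add_atTop_nhds_zero_nat (𝕜 := ℝ)).comp (tendsto_add_atTop_nat 2) |>.congr
      fun n => by simp only [Function.comp]; push_cast; ring_nf
  · filter_upwards [hd.eventually_le_const one_pos, hd.eventually_const_le (neg_lt_zero.2 one_pos)]
      with n h1 h2
    have := abs_le.1 (hC _ (hmem n))
    rw [abs_le]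
    constructor <;> linarith
  · obtain ⟨c, hc, hcle⟩ := exists_forall_le_neg_of_isCompact
      (isCompact_Icc (a := max 0 (a + δ)) (b := (1 : ℝ)))
      (hg.mono (Set.Icc_subset_Icc_left (le_max_left _ _)))
      (fun x hx => by
        have := max_le_iff.1 hx.1
        linarith [hgt x ⟨this.1, hx.2⟩ (by linarith)])
    refine ⟨c / 2, by positivity, ?_⟩
    filter_upwards [hd.eventually_le_const (half_pos hc)] with n hn hx
    linarith [hcle _ ⟨max_le (hmem n).1 hx, (hmem n).2⟩]
  · obtain ⟨c, hc, hcle⟩ := exists_forall_le_neg_of_isCompact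
      (isCompact_Icc (a := (0 : ℝ)) (b := min 1 (a - δ)))
      (hg.neg.mono (Set.Icc_subset_Icc_right (min_le_left _ _)))
      (fun x hx => by
        have := le_min_iff.1 hx.2
        simp only [Pi.neg_apply]
        linarith [hlt x ⟨hx.1, this.1⟩ (by linarith)])
    refine ⟨c / 2, by positivity, ?_⟩
    filter_upwards [hd.eventually_const_le (neg_lt_zero.2 (half_pos hc))] with n hn hx
    have := hcle _ ⟨(hmem n).1, le_min (hmem n).2 hx⟩
    simp only [Pi.neg_apply] at this
    linarith

/-- Weighted sums of bounded martingale differences with square summable weights converge almost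
surely, because they form an `L²`-bounded martingale. -/
theorem ae_exists_tendsto_sum_mul_of_condExp_eq_zero {Ω : Type*} {m : MeasurableSpace Ω}
    {P : Measure Ω} [IsProbabilityMeasure P] (ℱ : Filtration ℕ m) {ξ : ℕ → Ω → ℝ} {C : ℝ}
    (hm : ∀ n, StronglyMeasurable[ℱ (n + 1)] (ξ n)) (hb : ∀ n ω, |ξ n ω| ≤ C)
    (hc : ∀ n, P[ξ n | ℱ n] =ᵐ[P] 0) {γ : ℕ → ℝ} (hγ : Summable fun n => γ n ^ 2) :
    ∀ᵐ ω ∂P, ∃ w, Tendsto (fun n => ∑ i ∈ Finset.range n, γ i * ξ i ω) atTop (𝓝 w) := by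
  set W : ℕ → Ω → ℝ := fun n ω => ∑ i ∈ Finset.range n, γ i * ξ i ω with hW
  have hWs : ∀ n ω, W (n + 1) ω = W n ω + γ n * ξ n ω := fun n ω => by
    simp only [hW, Finset.sum_range_succ]
  have hWm : ∀ n, StronglyMeasurable[ℱ n] (W n) := fun n =>
    Finset.stronglyMeasurable_fun_sum _ fun i hi =>
      ((hm i).mono (ℱ.mono (Finset.mem_range.1 hi))).const_mul (γ i)
  have hWb : ∀ n, ∃ B, ∀ ω, |W n ω| ≤ B := fun n =>
    ⟨∑ i ∈ Finset.range n, |γ i| * C, fun ω => (Finset.abs_sum_le_sum_abs _ _).trans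
      (Finset.sum_le_sum fun i _ => by
        rw [abs_mul]; exact mul_le_mul_of_nonneg_left (hb i ω) (abs_nonneg _))⟩
  have hint : ∀ {f : Ω → ℝ} (B : ℝ), StronglyMeasurable f → (∀ ω, |f ω| ≤ B) → Integrable f P :=
    fun B hf h => .of_bound hf.aestronglyMeasurable B (.of_forall h)
  have hξm : ∀ n, StronglyMeasurable (ξ n) := fun n => (hm n).mono (ℱ.le _)
  have hWm' : ∀ n, StronglyMeasurable (W n) := fun n => (hWm n).mono (ℱ.le _)
  have hξi : ∀ n, Integrable (ξ n) P := fun n => hint C (hξm n) (hb n)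
  have hWi : ∀ n, Integrable (W n) P := fun n =>
    let ⟨B, hB⟩ := hWb n; hint B (hWm' n) hB
  have hmart : Martingale W ℱ P := by
    refine martingale_of_condExp_sub_eq_zero_nat hWm hWi fun n => ?_
    have : W (n + 1) - W n = γ n • ξ n := by
      ext ω; simp [hWs]
    rw [this]
    filter_upwards [condExp_smul (γ n) (ξ n) (ℱ n) (μ := P), hc n] with ω h1 h2
    rw [h1, Pi.smul_apply, h2]; simp
  -- the increment at step `n` is orthogonal to the martingale, by conditioning on the past
  have hcross : ∀ n, Integrable (fun ω => W n ω * ξ n ω) P ∧ ∫ ω, W n ω * ξ n ω ∂P = 0 := by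
    intro n
    obtain ⟨B, hB⟩ := hWb n
    have hi : Integrable (W n * ξ n) P := hint (B * C) ((hWm' n).mul (hξm n)) fun ω => by
      rw [Pi.mul_apply, abs_mul]
      exact mul_le_mul (hB ω) (hb n ω) (abs_nonneg _) ((abs_nonneg _).trans (hB ω))
    refine ⟨hi, ?_⟩
    have h1 := condExp_mul_of_stronglyMeasurable_left (hWm n) hi (hξi n)
    calc ∫ ω, W n ω * ξ n ω ∂P = ∫ ω, (P[W n * ξ n | ℱ n]) ω ∂P := (integral_condExp (ℱ.le n)).symm
      _ = ∫ _, (0 : ℝ) ∂P := integral_congr_ae (by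
          filter_upwards [h1, hc n] with ω h1 h2
          rw [h1, Pi.mul_apply, h2]; simp)
      _ = 0 := by simp
  have hsq : ∀ n, Integrable (fun ω => W n ω ^ 2) P := fun n => by
    obtain ⟨B, hB⟩ := hWb n
    exact hint (B ^ 2) ((hWm' n).pow 2) fun ω => by
      rw [abs_pow]; exact pow_le_pow_left₀ (abs_nonneg _) (hB ω) 2
  have hξsq : ∀ n, Integrable (fun ω => ξ n ω ^ 2) P := fun n =>
    hint (C ^ 2) ((hξm n).pow 2) fun ω => by
      rw [abs_pow]; exact pow_le_pow_left₀ (abs_nonneg _) (hb n ω) 2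
  have hL2 : ∀ n, ∫ ω, W n ω ^ 2 ∂P ≤ C ^ 2 * ∑ i ∈ Finset.range n, γ i ^ 2 := by
    intro n
    induction n with
    | zero => simp [hW]
    | succ n ih =>
      have hexp : ∀ ω, W (n + 1) ω ^ 2
          = W n ω ^ 2 + 2 * γ n * (W n ω * ξ n ω) + γ n ^ 2 * ξ n ω ^ 2 := fun ω => by
        rw [hWs]; ring
      have hi : Integrable (fun ω => W n ω ^ 2 + 2 * γ n * (W n ω * ξ n ω)) P :=
        (hsq n).add ((hcross n).1.const_mul _)
      simp_rw [hexp]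
      rw [integral_add hi ((hξsq n).const_mul _),
        integral_add (hsq n) ((hcross n).1.const_mul _), integral_const_mul, integral_const_mul,
        (hcross n).2, Finset.sum_range_succ]
      have : ∫ ω, ξ n ω ^ 2 ∂P ≤ C ^ 2 := by
        calc ∫ ω, ξ n ω ^ 2 ∂P ≤ ∫ _, C ^ 2 ∂P :=
              integral_mono (hξsq n) (integrable_const _) fun ω =>
                sq_le_sq' (by linarith [(abs_le.1 (hb n ω)).1]) (abs_le.1 (hb n ω)).2
          _ = C ^ 2 := by simp
      nlinarith [sq_nonneg (γ n)]
  refine hmart.submartingale.exists_ae_tendsto_of_bdd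
    (R := Real.toNNReal (1 + C ^ 2 * ∑' i, γ i ^ 2)) fun n => ?_
  rw [eLpNorm_one_eq_lintegral_enorm, ← ofReal_integral_norm_eq_lintegral_enorm (hWi n)]
  refine ENNReal.ofReal_le_ofReal ?_
  calc ∫ ω, ‖W n ω‖ ∂P ≤ ∫ ω, (1 + W n ω ^ 2) ∂P :=
        integral_mono (hWi n).norm ((integrable_const _).add (hsq n)) fun ω => by
          simp only [Real.norm_eq_abs]
          nlinarith [sq_nonneg (|W n ω| - 1), sq_abs (W n ω)]
    _ = 1 + ∫ ω, W n ω ^ 2 ∂P := by rw [integral_add (integrable_const _) (hsq n)]; simp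
    _ ≤ _ := by
      have := hγ.sum_le_tsum (Finset.range n) fun i _ => sq_nonneg _
      nlinarith [hL2 n, sq_nonneg C, mul_le_mul_of_nonneg_left this (sq_nonneg C)]

/-! ### The limiting share -/

instance : Fintype Color := ⟨{Color.red, Color.blue}, fun c => by cases c <;> simp⟩

theorem Color.sum_univ {M : Type*} [AddCommMonoid M] (f : Color → M) :
    ∑ c, f c = f Color.red + f Color.blue := by
  change ∑ c ∈ {Color.red, Color.blue}, f c = _
  rw [Finset.sum_pair (by simp)]

/-- The shares of red and blue in a total in which red has share `x`. -/
def share (x : ℝ) : Color → ℝ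
  | .red => x
  | .blue => 1 - x

/-- The probability with which a member of color `m` accepts a proposed group of color `g`, when
`rho m` is the probability to accept the other color. -/
def acceptance (rho : Color → ℝ) (m g : Color) : ℝ := if g = m then 1 else rho m

namespace Params

variable (Θ : Params)

/-- The probability that a single attempt of a member of color `m` succeeds, when `x` and `z` are
the shares of the colors in the total of the group sizes and in the number of groups. -/
noncomputable def successProb (m : Color) (x z : Color → ℝ) : ℝ :=
  Θ.xi * ∑ c, acceptance Θ.rhoP m c * x c + (1 - Θ.xi) * ∑ c, acceptance Θ.rhoU m c * z c

theorem successProb_red (a : ℝ) :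
    Θ.successProb .red (share a) Θ.colorProb = Θ.denomRed a := by
  simp only [successProb, Color.sum_univ, acceptance, share, colorProb, denomRed, if_true,
    reduceCtorEq, if_false]
  ring

theorem successProb_blue (a : ℝ) :
    Θ.successProb .blue (share a) Θ.colorProb = Θ.denomBlue a := by
  simp only [successProb, Color.sum_univ, acceptance, share, colorProb, denomBlue, if_true,
    reduceCtorEq, if_false]
  ring

theorem shareMap_eq (a : ℝ) :
    Θ.shareMap a = ∑ m, Θ.colorProb m * (Θ.eta * (if m = .red then 1 else 0) + (1 - Θ.eta) *
      ((Θ.xi * a * acceptance Θ.rhoP m .red + (1 - Θ.xi) * Θ.r * acceptance Θ.rhoU m .red)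
        / Θ.successProb m (share a) Θ.colorProb)) := by
  rw [Color.sum_univ, successProb_red, successProb_blue]
  simp only [shareMap, acceptance, colorProb, if_true, reduceCtorEq, if_false]
  ring

theorem C1_eq (a : ℝ) (c : Color) :
    Θ.C1 a c = ∑ m, Θ.colorProb m * ((1 - Θ.eta) * (Θ.xi * acceptance Θ.rhoP m c
      / Θ.successProb m (share a) Θ.colorProb)) := by
  rw [Color.sum_univ, successProb_red, successProb_blue]
  cases c <;> simp only [C1, acceptance, colorProb, if_true, reduceCtorEq, if_false] <;> ring

theorem C2_eq (a : ℝ) (c : Color) :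
    Θ.C2 a c = ∑ m, Θ.colorProb m * ((1 - Θ.eta) * ((1 - Θ.xi) * acceptance Θ.rhoU m c *
      (1 / Θ.eta) / Θ.successProb m (share a) Θ.colorProb)) := by
  rw [Color.sum_univ, successProb_red, successProb_blue]
  cases c <;> simp only [C2, acceptance, colorProb, if_true, reduceCtorEq, if_false] <;> ring

theorem colorProb_pos (c : Color) : 0 < Θ.colorProb c := by
  cases c
  · exact Θ.r_pos
  · simp only [colorProb]; linarith [Θ.r_le_half]

theorem sum_colorProb : ∑ c, Θ.colorProb c = 1 := by
  rw [Color.sum_univ]; simp [colorProb]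

theorem acceptance_nonneg {rho : Color → ℝ} (h : ∀ c, 0 ≤ rho c) (m g : Color) :
    0 ≤ acceptance rho m g := by
  unfold acceptance; split_ifs <;> simp [h]

theorem successProb_pos (hρ : ∀ c, 0 < Θ.rhoP c) (m : Color) {x z : Color → ℝ}
    (hx : ∀ c, 0 ≤ x c) (hx1 : ∑ c, x c = 1) (hz : ∀ c, 0 < z c) : 0 < Θ.successProb m x z := by
  have hP : ∀ c, 0 < acceptance Θ.rhoP m c := fun c => by
    unfold acceptance; split_ifs <;> simp [hρ]
  have h1 : 0 < ∑ c, acceptance Θ.rhoP m c * x c := by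
    obtain ⟨c, -, hc⟩ : ∃ c ∈ Finset.univ, 0 < x c :=
      Finset.exists_lt_of_sum_lt (by simp [hx1] : ∑ c, (0 : ℝ) < ∑ c, x c)
    exact Finset.sum_pos' (fun c _ => mul_nonneg (hP c).le (hx c))
      ⟨c, Finset.mem_univ _, mul_pos (hP c) hc⟩
  have h2 : 0 < ∑ c, acceptance Θ.rhoU m c * z c :=
    Finset.sum_pos' (fun c _ => mul_nonneg (acceptance_nonneg Θ.rhoU_nonneg _ _) (hz c).le)
      ⟨m, Finset.mem_univ _, by simp [acceptance, hz]⟩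
  unfold successProb
  rcases Θ.xi_nonneg.eq_or_lt with h | h
  · simp [← h, h2]
  · have := mul_nonneg (sub_nonneg.2 Θ.xi_le_one) h2.le
    have := mul_pos h h1
    linarith

theorem successProb_share_pos (hρ : ∀ c, 0 < Θ.rhoP c) (m : Color) {x : ℝ}
    (hx : x ∈ Set.Icc (0 : ℝ) 1) : 0 < Θ.successProb m (share x) Θ.colorProb :=
  Θ.successProb_pos hρ m (fun c => by cases c <;> simp [share, hx.1, hx.2])
    (by rw [Color.sum_univ]; simp [share]) Θ.colorProb_pos

end Params

/-- If a cubic with nonnegative leading coefficient is positive at `0` and negative at `1`, then it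
has at most one root in `(0, 1)`: with two roots there, the cofactor `p₃ * z + d` would be positive at
`0`, hence also at `1`. -/
theorem cubic_root_unique {p₀ p₁ p₂ p₃ x y : ℝ} (h3 : 0 ≤ p₃) (h0 : 0 < p₀)
    (h1 : p₃ + p₂ + p₁ + p₀ < 0) (hx0 : 0 < x) (hx1 : x < 1) (hy0 : 0 < y) (hy1 : y < 1)
    (hx : p₃ * x ^ 3 + p₂ * x ^ 2 + p₁ * x + p₀ = 0)
    (hy : p₃ * y ^ 3 + p₂ * y ^ 2 + p₁ * y + p₀ = 0) : x = y := by
  by_contra hne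
  have hq : p₃ * (x ^ 2 + x * y + y ^ 2) + p₂ * (x + y) + p₁ = 0 := by
    apply mul_left_cancel₀ (sub_ne_zero.2 hne)
    linear_combination hx - hy
  -- the cubic is `(z - x) * (z - y) * (p₃ * z + d)`
  set d := p₂ + p₃ * (x + y) with hd
  have e0 : p₀ = x * y * d := by rw [hd]; linear_combination hx - x * hq
  have e1 : p₃ + p₂ + p₁ + p₀ = (1 - x) * (1 - y) * (p₃ + d) := by
    rw [hd]; linear_combination hx + (1 - x) * hq
  have hdpos : 0 < d := by
    rw [e0] at h0
    exact pos_of_mul_pos_right h0 (by positivity)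
  have := mul_pos (mul_pos (sub_pos.2 hx1) (sub_pos.2 hy1)) (by linarith : 0 < p₃ + d)
  linarith

namespace Params

variable (Θ : Params)

theorem denomRed_pos (hρ : ∀ c, 0 < Θ.rhoP c) {x : ℝ} (hx : x ∈ Set.Icc (0 : ℝ) 1) :
    0 < Θ.denomRed x := Θ.successProb_red x ▸ Θ.successProb_share_pos hρ .red hx

theorem denomBlue_pos (hρ : ∀ c, 0 < Θ.rhoP c) {x : ℝ} (hx : x ∈ Set.Icc (0 : ℝ) 1) :
    0 < Θ.denomBlue x := Θ.successProb_blue x ▸ Θ.successProb_share_pos hρ .blue hx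

theorem shareMap_zero_pos (hρ : ∀ c, 0 < Θ.rhoP c) : 0 < Θ.shareMap 0 := by
  have h0 : (0 : ℝ) ∈ Set.Icc (0 : ℝ) 1 := by simp
  have := Θ.denomRed_pos hρ h0
  have := Θ.denomBlue_pos hρ h0
  have := Θ.r_pos
  have := Θ.eta_pos
  have := sub_nonneg.2 Θ.eta_lt_one.le
  have := sub_nonneg.2 Θ.xi_le_one
  have := (Θ.colorProb_pos .blue).le
  have := Θ.rhoU_nonneg .blue
  simp only [colorProb] at *
  unfold shareMap
  rw [mul_zero, mul_zero, zero_add, zero_add]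
  positivity

theorem shareMap_one_lt (hρ : ∀ c, 0 < Θ.rhoP c) : Θ.shareMap 1 < 1 := by
  have h1 : (1 : ℝ) ∈ Set.Icc (0 : ℝ) 1 := by simp
  have hr := Θ.r_pos
  have hr' := (Θ.colorProb_pos .blue)
  simp only [colorProb] at hr'
  have he := Θ.eta_pos
  have he' := sub_nonneg.2 Θ.eta_lt_one.le
  have hx' := sub_nonneg.2 Θ.xi_le_one
  have hred : (Θ.xi * 1 + (1 - Θ.xi) * Θ.r) / Θ.denomRed 1 ≤ 1 := by
    rw [div_le_one (Θ.denomRed_pos hρ h1)]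
    unfold denomRed
    nlinarith [mul_nonneg (mul_nonneg hx' hr'.le) (Θ.rhoU_nonneg .red)]
  have hblue : (Θ.rhoP .blue * Θ.xi * 1 + Θ.rhoU .blue * (1 - Θ.xi) * Θ.r) / Θ.denomBlue 1 ≤ 1 := by
    rw [div_le_one (Θ.denomBlue_pos hρ h1)]
    unfold denomBlue
    nlinarith [mul_nonneg hx' hr'.le]
  unfold shareMap
  rw [mul_div_assoc, mul_div_assoc]
  have a1 := mul_le_mul_of_nonneg_left hred (mul_nonneg hr.le he')
  have a2 := mul_le_mul_of_nonneg_left hblue (mul_nonneg hr'.le he')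
  nlinarith [mul_pos hr' he]

theorem continuousOn_shareMap (hρ : ∀ c, 0 < Θ.rhoP c) :
    ContinuousOn Θ.shareMap (Set.Icc 0 1) := by
  have hR : ContinuousOn Θ.denomRed (Set.Icc 0 1) := by unfold denomRed; fun_prop
  have hB : ContinuousOn Θ.denomBlue (Set.Icc 0 1) := by unfold denomBlue; fun_prop
  unfold shareMap
  refine (ContinuousOn.add continuousOn_const (ContinuousOn.div (by fun_prop) hR fun x hx =>
    (Θ.denomRed_pos hρ hx).ne')).add (ContinuousOn.div (by fun_prop) hB fun x hx =>
    (Θ.denomBlue_pos hρ hx).ne')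

/-- The numerator of `shareMap z - z` is a cubic polynomial with leading coefficient
`(1 - rhoP red) * xi * ((1 - rhoP blue) * xi) ≥ 0`. -/
theorem shareMap_fixedPoint_unique (hρ : ∀ c, 0 < Θ.rhoP c) {x y : ℝ}
    (hx : x ∈ Set.Ioo (0 : ℝ) 1) (hy : y ∈ Set.Ioo (0 : ℝ) 1)
    (hfx : Θ.shareMap x = x) (hfy : Θ.shareMap y = y) : x = y := by
  -- `hnum` is the numerator of `shareMap z - z`, written out as a cubic polynomial in `z`
  set u₁ := (1 - Θ.rhoP .red) * Θ.xi with hu₁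
  set u₀ := Θ.denomRed 0 with hu₀
  set v₁ := (1 - Θ.rhoP .blue) * Θ.xi with hv₁
  set v₀ := Θ.denomBlue 0 with hv₀
  set e := Θ.r * Θ.eta with he
  set k := Θ.r * (1 - Θ.eta) * Θ.xi with hk
  set l := Θ.r * (1 - Θ.eta) * ((1 - Θ.xi) * Θ.r) with hl
  set m := (1 - Θ.r) * (1 - Θ.eta) * (Θ.rhoP .blue * Θ.xi) with hm
  set n := (1 - Θ.r) * (1 - Θ.eta) * (Θ.rhoU .blue * (1 - Θ.xi) * Θ.r) with hn
  have hDR : ∀ z, Θ.denomRed z = u₀ + u₁ * z := fun z => by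
    simp only [hu₀, hu₁, denomRed]; ring
  have hDB : ∀ z, Θ.denomBlue z = v₀ - v₁ * z := fun z => by
    simp only [hv₀, hv₁, denomBlue]; ring
  have hnum : ∀ z ∈ Set.Icc (0 : ℝ) 1,
      u₁ * v₁ * z ^ 3 + (-(e * u₁ * v₁) - k * v₁ + m * u₁ - (u₁ * v₀ - u₀ * v₁)) * z ^ 2
        + (e * (u₁ * v₀ - u₀ * v₁) + k * v₀ - l * v₁ + m * u₀ + n * u₁ - u₀ * v₀) * z
        + (e * u₀ * v₀ + l * v₀ + n * u₀)
      = (Θ.shareMap z - z) * (Θ.denomRed z * Θ.denomBlue z) := fun z hz => by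
    have h1 := (Θ.denomRed_pos hρ hz).ne'
    have h2 := (Θ.denomBlue_pos hρ hz).ne'
    have : (Θ.shareMap z - z) * (Θ.denomRed z * Θ.denomBlue z)
        = (e - z) * (Θ.denomRed z * Θ.denomBlue z) + (k * z + l) * Θ.denomBlue z
          + (m * z + n) * Θ.denomRed z := by
      simp only [shareMap, he, hk, hl, hm, hn]
      field_simp
      ring
    rw [this, hDR, hDB]
    ring
  have h0 := hnum 0 (by simp)
  have h1 := hnum 1 (by simp)
  have pos : ∀ z ∈ Set.Icc (0 : ℝ) 1, 0 < Θ.denomRed z * Θ.denomBlue z := fun z hz =>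
    mul_pos (Θ.denomRed_pos hρ hz) (Θ.denomBlue_pos hρ hz)
  refine cubic_root_unique (x := x) (y := y) ?_ ?_ ?_ hx.1 hx.2 hy.1 hy.2
    ((hnum x ⟨hx.1.le, hx.2.le⟩).trans (by rw [hfx]; ring))
    ((hnum y ⟨hy.1.le, hy.2.le⟩).trans (by rw [hfy]; ring))
  · exact mul_nonneg (mul_nonneg (sub_nonneg.2 (Θ.rhoP_le_one _)) Θ.xi_nonneg)
      (mul_nonneg (sub_nonneg.2 (Θ.rhoP_le_one _)) Θ.xi_nonneg)
  · have := mul_pos (Θ.shareMap_zero_pos hρ) (pos 0 (by simp))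
    rw [sub_zero] at h0
    linarith
  · have := mul_neg_of_neg_of_pos (sub_neg.2 (Θ.shareMap_one_lt hρ)) (pos 1 (by simp))
    linarith

/-- At its fixed point the graph of `shareMap` crosses the diagonal downwards; this makes the fixed
point attracting. -/
theorem exists_shareMap_fixedPoint (hρ : ∀ c, 0 < Θ.rhoP c) :
    ∃ a ∈ Set.Ioo (0 : ℝ) 1, Θ.shareMap a = a ∧
      (∀ x ∈ Set.Icc (0 : ℝ) 1, x < a → x < Θ.shareMap x) ∧
      (∀ x ∈ Set.Icc (0 : ℝ) 1, a < x → Θ.shareMap x < x) := by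
  have h0 := Θ.shareMap_zero_pos hρ
  have h1 := Θ.shareMap_one_lt hρ
  have hcont : ContinuousOn (fun x => Θ.shareMap x - x) (Set.Icc 0 1) :=
    (Θ.continuousOn_shareMap hρ).sub continuousOn_id
  -- a zero of `shareMap x - x` in any subinterval across which the sign changes
  have hzero : ∀ x y, 0 ≤ x → x ≤ y → y ≤ 1 → 0 ≤ Θ.shareMap x - x → Θ.shareMap y - y ≤ 0 →
      ∃ z ∈ Set.Icc x y, Θ.shareMap z = z := fun x y hx hxy hy hfx hfy => by
    obtain ⟨z, hz, hz'⟩ := intermediate_value_Icc' hxy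
      (hcont.mono (Set.Icc_subset_Icc hx hy)) ⟨hfy, hfx⟩
    exact ⟨z, hz, sub_eq_zero.1 hz'⟩
  have hne : ∀ z ∈ Set.Icc (0 : ℝ) 1, Θ.shareMap z = z → z ∈ Set.Ioo (0 : ℝ) 1 := fun z hz hfz =>
    ⟨hz.1.lt_of_ne (by rintro rfl; linarith), hz.2.lt_of_ne (by rintro rfl; linarith)⟩
  obtain ⟨a, ha, hfa⟩ := hzero 0 1 le_rfl zero_le_one le_rfl (by linarith) (by linarith)
  have ha' := hne a ha hfa
  refine ⟨a, ha', hfa, fun x hx hxa => ?_, fun x hx hxa => ?_⟩ <;> by_contra! hcon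
  · obtain ⟨z, hz, hfz⟩ := hzero 0 x le_rfl hx.1 hx.2 (by linarith) (by linarith)
    have := Θ.shareMap_fixedPoint_unique hρ ha' (hne z ⟨hz.1, hz.2.trans hx.2⟩ hfz) hfa hfz
    linarith [hz.2]
  · obtain ⟨z, hz, hfz⟩ := hzero x 1 hx.1 hx.2 le_rfl (by linarith) (by linarith)
    have := Θ.shareMap_fixedPoint_unique hρ ha' (hne z ⟨hx.1.trans hz.1, hz.2⟩ hfz) hfa hfz
    linarith [hz.1]

theorem C1_pos (hρ : ∀ c, 0 < Θ.rhoP c) (hxi : 0 < Θ.xi) {a : ℝ} (ha : a ∈ Set.Icc (0 : ℝ) 1)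
    (c : Color) : 0 < Θ.C1 a c := by
  rw [C1_eq]
  refine Finset.sum_pos (fun m _ => mul_pos (Θ.colorProb_pos m) (mul_pos
    (sub_pos.2 Θ.eta_lt_one) (div_pos (mul_pos hxi ?_) (Θ.successProb_share_pos hρ m ha))))
    ⟨.red, Finset.mem_univ _⟩
  unfold acceptance
  split_ifs <;> simp [hρ]

theorem C1_nonneg (hρ : ∀ c, 0 < Θ.rhoP c) {a : ℝ} (ha : a ∈ Set.Icc (0 : ℝ) 1)
    (c : Color) : 0 ≤ Θ.C1 a c := by
  rw [C1_eq]
  exact Finset.sum_nonneg fun m _ => mul_nonneg (Θ.colorProb_pos m).le (mul_nonneg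
    (sub_nonneg.2 Θ.eta_lt_one.le) (div_nonneg (mul_nonneg Θ.xi_nonneg
      (acceptance_nonneg Θ.rhoP_nonneg _ _)) (Θ.successProb_share_pos hρ m ha).le))

theorem C2_nonneg (hρ : ∀ c, 0 < Θ.rhoP c) {a : ℝ} (ha : a ∈ Set.Icc (0 : ℝ) 1)
    (c : Color) : 0 ≤ Θ.C2 a c := by
  rw [C2_eq]
  exact Finset.sum_nonneg fun m _ => mul_nonneg (Θ.colorProb_pos m).le (mul_nonneg
    (sub_nonneg.2 Θ.eta_lt_one.le) (div_nonneg (mul_nonneg (mul_nonneg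
      (sub_nonneg.2 Θ.xi_le_one) (acceptance_nonneg Θ.rhoU_nonneg _ _))
      (one_div_nonneg.2 Θ.eta_pos.le)) (Θ.successProb_share_pos hρ m ha).le))

end Params

/-! ### The power law -/

/-- The recursion is solved by a quotient of two rising factorials, which Euler's limit formula for
the Gamma function compares with a power of `k`. -/
theorem exists_isEquivalent_rpow_of_recursion {G : ℕ → ℝ} {c₁ c₂ : ℝ} (h1 : 0 < c₁) (h2 : 0 ≤ c₂)
    (hG1 : 0 < G 1)
    (hG : ∀ k : ℕ, 2 ≤ k → G k = G (k - 1) * ((((k : ℝ) - 1) * c₁ + c₂) / (1 + k * c₁ + c₂))) :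
    ∃ A : ℝ, 0 < A ∧ G ~[atTop] fun k : ℕ => A * (k : ℝ) ^ (-(1 + 1 / c₁)) := by
  set s : ℝ := 1 + c₂ / c₁ with hs
  set u : ℝ := s + (1 + 1 / c₁) with hu
  have hs0 : 0 < s := by positivity
  have hu0 : 0 < u := by positivity
  have hprod : ∀ n : ℕ, G (n + 2) = G 1 *
      ((∏ j ∈ Finset.range (n + 1), (s + j)) / ∏ j ∈ Finset.range (n + 1), (u + j)) := by
    have hstep : ∀ n : ℕ, G (n + 2) = G (n + 1) * ((s + n) / (u + n)) := fun n => by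
      rw [hG (n + 2) (by omega), show n + 2 - 1 = n + 1 by omega]
      congr 1
      rw [div_eq_div_iff (by positivity) (by positivity), hu, hs]
      push_cast
      field_simp
      ring
    intro n
    induction n with
    | zero => simpa using hstep 0
    | succ n ih =>
      rw [hstep, show n + 1 + 1 = n + 2 by ring, ih, Finset.prod_range_succ _ (n + 1),
        Finset.prod_range_succ _ (n + 1), mul_div_mul_comm]
      ring
  have hgam : ∀ n : ℕ, 1 ≤ n → G (n + 2) / (n : ℝ) ^ (-(1 + 1 / c₁))
      = G 1 * (Real.GammaSeq u n / Real.GammaSeq s n) := fun n hn => by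
    have hn0 : (0 : ℝ) < n := by exact_mod_cast hn
    have hps : ∏ j ∈ Finset.range (n + 1), (s + j) ≠ 0 :=
      (Finset.prod_pos fun j _ => by positivity).ne'
    have hpu : ∏ j ∈ Finset.range (n + 1), (u + j) ≠ 0 :=
      (Finset.prod_pos fun j _ => by positivity).ne'
    have hf : (n.factorial : ℝ) ≠ 0 := by exact_mod_cast n.factorial_ne_zero
    have hr : ((n : ℝ) ^ (-(1 + 1 / c₁)))⁻¹ = (n : ℝ) ^ (1 + 1 / c₁) := by
      rw [Real.rpow_neg hn0.le, inv_inv]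
    have hps' := (Real.rpow_pos_of_pos hn0 s).ne'
    have hpow : (n : ℝ) ^ u = (n : ℝ) ^ s * (n : ℝ) ^ (1 + 1 / c₁) := Real.rpow_add hn0 _ _
    rw [hprod, Real.GammaSeq, Real.GammaSeq, div_eq_mul_inv _ ((n : ℝ) ^ _), hr, hpow]
    generalize (n : ℝ) ^ (1 + 1 / c₁) = p
    field_simp
  have hshift : Tendsto (fun n : ℕ => ((n : ℝ) / ((n + 2 : ℕ) : ℝ)) ^ (-(1 + 1 / c₁))) atTop
      (𝓝 1) := by
    have h : Tendsto (fun n : ℕ => (n : ℝ) / ((n + 2 : ℕ) : ℝ)) atTop (𝓝 1) := by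
      simpa using tendsto_natCast_div_add_atTop (2 : ℝ)
    simpa using h.rpow_const (p := -(1 + 1 / c₁)) (Or.inl one_ne_zero)
  set A := G 1 * (Real.Gamma u / Real.Gamma s) with hA
  have hA0 : 0 < A := mul_pos hG1 (div_pos (Real.Gamma_pos_of_pos hu0) (Real.Gamma_pos_of_pos hs0))
  have hlim : Tendsto (fun n : ℕ => G (n + 2) / ((n + 2 : ℕ) : ℝ) ^ (-(1 + 1 / c₁))) atTop
      (𝓝 A) := by
    have h := (((Real.GammaSeq_tendsto_Gamma u).div (Real.GammaSeq_tendsto_Gamma s)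
      (Real.Gamma_pos_of_pos hs0).ne').const_mul (G 1)).mul hshift
    rw [mul_one] at h
    refine h.congr' ?_
    filter_upwards [eventually_ge_atTop 1] with n hn
    have hn0 : (0 : ℝ) < n := by exact_mod_cast hn
    have := (Real.rpow_pos_of_pos hn0 (-(1 + 1 / c₁))).ne'
    rw [Pi.div_apply, ← hgam n hn, Real.div_rpow hn0.le (by positivity)]
    field_simp
  refine ⟨A, hA0, ?_⟩
  have hlim' := (tendsto_add_atTop_iff_nat
    (f := fun n : ℕ => G n / (n : ℝ) ^ (-(1 + 1 / c₁))) 2).1 hlim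
  refine isEquivalent_of_tendsto_one ?_
  have := hlim'.div_const A
  rw [div_self hA0.ne'] at this
  refine this.congr fun n => ?_
  simp only [Pi.div_apply]
  rw [div_div, mul_comm A]

/-! ### Expectations under the transition probabilities -/

section Expectation

variable {α β : Type*}

/-- The expectation of a (bounded) function under a probability mass function. -/
noncomputable def expect (p : PMF α) (f : α → ℝ) : ℝ := ∑' a, (p a).toReal * f a

theorem summable_toReal (p : PMF α) : Summable fun a => (p a).toReal :=
  ENNReal.summable_toReal (by rw [p.tsum_coe]; exact ENNReal.one_ne_top)

theorem tsum_toReal (p : PMF α) : ∑' a, (p a).toReal = 1 := by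
  rw [← ENNReal.tsum_toReal_eq p.apply_ne_top, p.tsum_coe, ENNReal.toReal_one]

theorem abs_expect_le (p : PMF α) {f : α → ℝ} {C : ℝ} (hf : ∀ a, |f a| ≤ C) :
    |expect p f| ≤ C := by
  have h : HasSum (fun a => (p a).toReal * C) C := by
    have := (summable_toReal p).hasSum.mul_right C
    rwa [tsum_toReal, one_mul] at this
  rw [← Real.norm_eq_abs]
  refine tsum_of_norm_bounded h fun a => ?_
  rw [Real.norm_eq_abs, abs_mul, abs_of_nonneg ENNReal.toReal_nonneg]
  exact mul_le_mul_of_nonneg_left (hf a) ENNReal.toReal_nonneg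

theorem expect_pure (a : α) (f : α → ℝ) : expect (PMF.pure a) f = f a := by
  classical
  rw [expect, tsum_eq_single a fun b hb => by simp [PMF.pure_apply, hb]]
  simp

theorem expect_bind (p : PMF α) (q : α → PMF β) {f : β → ℝ} {C : ℝ} (hf : ∀ b, |f b| ≤ C) :
    expect (p.bind q) f = expect p fun a => expect (q a) f := by
  have hsum : Summable (Function.uncurry fun a b => (p a).toReal * ((q a b).toReal * f b)) := by
    have hC : Summable fun x : α × β => (p x.1).toReal * ((q x.1 x.2).toReal * C) := by
      rcases isEmpty_or_nonempty β with hβ | ⟨⟨b⟩⟩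
      · exact (hasSum_empty).summable
      have hC0 : 0 ≤ C := (abs_nonneg _).trans (hf b)
      rw [summable_prod_of_nonneg fun x => mul_nonneg ENNReal.toReal_nonneg
        (mul_nonneg ENNReal.toReal_nonneg hC0)]
      refine ⟨fun a => ((summable_toReal (q a)).mul_right C).mul_left (p a).toReal, ?_⟩
      simp_rw [tsum_mul_left, tsum_mul_right, tsum_toReal]
      exact (summable_toReal p).mul_right _
    refine .of_norm_bounded hC fun x => ?_
    simp only [Function.uncurry, Real.norm_eq_abs, abs_mul, abs_of_nonneg ENNReal.toReal_nonneg]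
    gcongr
    exact hf _
  have hb : ∀ b, ((p.bind q) b).toReal * f b = ∑' a, (p a).toReal * ((q a b).toReal * f b) := by
    intro b
    rw [PMF.bind_apply, ENNReal.tsum_toReal_eq fun a =>
      ENNReal.mul_ne_top (p.apply_ne_top a) ((q a).apply_ne_top b), ← tsum_mul_right]
    exact tsum_congr fun a => by rw [ENNReal.toReal_mul, mul_assoc]
  unfold expect
  simp_rw [hb]
  rw [hsum.tsum_comm]
  exact tsum_congr fun a => tsum_mul_left

theorem expect_map (p : PMF α) (g : α → β) {f : β → ℝ} {C : ℝ} (hf : ∀ b, |f b| ≤ C) :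
    expect (p.map g) f = expect p fun a => f (g a) := by
  rw [PMF.map, expect_bind p _ hf]
  simp only [Function.comp, expect_pure]

theorem expect_coin (p : ℝ) (h0 : 0 ≤ p) (h1 : p ≤ 1) (f : Bool → ℝ) :
    expect (coin p h0 h1) f = p * f true + (1 - p) * f false := by
  rw [expect, tsum_fintype, Fintype.sum_bool]
  simp [coin, ENNReal.toReal_ofReal, h0, h1]

theorem expect_pick (n : ℕ) (w : ℕ → ℕ) (h : ∑ i ∈ Finset.range n, w i ≠ 0) (f : ℕ → ℝ) :
    expect (pick n w) f
      = (∑ i ∈ Finset.range n, (w i : ℝ) * f i) / ((∑ i ∈ Finset.range n, w i : ℕ) : ℝ) := by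
  have hp : ∀ i, (pick n w i).toReal
      = if i < n then (w i : ℝ) / ((∑ i ∈ Finset.range n, w i : ℕ) : ℝ) else 0 := fun i => by
    rw [pick, dif_pos h, PMF.normalize_apply, tsum_pickWeight, ENNReal.toReal_mul,
      ENNReal.toReal_inv, ENNReal.toReal_natCast, pickWeight]
    split_ifs <;> simp [div_eq_mul_inv]
  rw [expect, tsum_eq_sum (s := Finset.range n) fun i hi => by
    rw [hp, if_neg (by simpa using hi), zero_mul], Finset.sum_div]
  refine Finset.sum_congr rfl fun i hi => ?_
  rw [hp, if_pos (Finset.mem_range.1 hi)]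
  ring

theorem expect_option (a : PMF (Option ℕ)) (f : ℕ → ℝ) :
    expect a (fun o => o.elim 0 f) = ∑' g, (a (some g)).toReal * f g := by
  rw [expect, ← (Option.some_injective ℕ).tsum_eq
    (f := fun o : Option ℕ => (a o).toReal * o.elim 0 f) (fun o ho => by cases o <;> simp_all)]
  rfl

/-- Repetition until the first success amounts to conditioning on success. -/
theorem expect_untilSuccess (a : PMF (Option ℕ)) (h : expect a (fun o => o.elim 0 fun _ => 1) ≠ 0)
    (f : ℕ → ℝ) : expect (untilSuccess a) f
      = expect a (fun o => o.elim 0 f) / expect a (fun o => o.elim 0 fun _ => 1) := by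
  have hsucc : expect a (fun o => o.elim 0 fun _ => 1) = (1 - a none).toReal := by
    rw [expect_option, ← tsum_some, ENNReal.tsum_toReal_eq fun g => a.apply_ne_top _]
    simp
  have hne : a none ≠ 1 := by
    rintro h1
    rw [hsucc, h1] at h
    simp at h
  rw [hsucc, expect_option, expect, ← tsum_div_const]
  refine tsum_congr fun g => ?_
  have : untilSuccess a g = (1 - a none)⁻¹ * a (some g) := by
    have e : untilSuccess a g = ∑' n : ℕ, a none ^ n * a (some g) := by
      unfold untilSuccess
      exact congrArg (fun q : PMF ℕ => q g) (dif_pos hne)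
    rw [e, ENNReal.tsum_mul_right, ENNReal.tsum_geometric]
  rw [this, ENNReal.toReal_mul, ENNReal.toReal_inv]
  ring

end Expectation

/-! ### Networks and their statistics -/

namespace Network

/-- Double counting of the entries of `l` whose key satisfies `p`. -/
theorem sum_range_countP {α : Type*} (l : List α) (key : α → ℕ) {n : ℕ}
    (h : ∀ e ∈ l, key e < n) (p : ℕ → Prop) [DecidablePred p] :
    ∑ i ∈ Finset.range n, (if p i then l.countP (fun e => key e = i) else 0)
      = l.countP fun e => p (key e) := by
  induction l with
  | nil => simp
  | cons e l ih =>
    have ih := ih fun x hx => h x (List.mem_cons_of_mem _ hx)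
    have he : key e ∈ Finset.range n := Finset.mem_range.2 (h e List.mem_cons_self)
    have hi : ∀ i ∈ Finset.range n, (if p i then (e :: l).countP (fun e => key e = i) else 0)
        = (if p i then l.countP (fun e => key e = i) else 0)
          + if key e = i then (if p (key e) then 1 else 0) else 0 := fun i _ => by
      rw [List.countP_cons]
      by_cases h1 : key e = i
      · subst h1; by_cases h2 : p (key e) <;> simp [h2]
      · simp [h1]
    rw [List.countP_cons, ← ih, Finset.sum_congr rfl hi, Finset.sum_add_distrib,
      Finset.sum_ite_eq, if_pos he]
    simp

/-- The invariants of the networks that occur in the model: connections are between existing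
members and groups, no group is empty, and there are groups of both colors. -/
structure Valid (N : Network) : Prop where
  edge : ∀ e ∈ N.edges, e.1 < N.members.length ∧ e.2 < N.groups.length
  size_pos : ∀ g < N.groups.length, 0 < N.groupSize g
  exists_color : ∀ c, ∃ g < N.groups.length, N.groupColor g = c

/-- The network `N'` and its member `m` are a possible outcome of member growth in `N`: the network
is unchanged up to a possible new member, and `m` is a member. -/
structure IsArrival (N N' : Network) (m : ℕ) : Prop where
  groups : N'.groups = N.groups
  edges : N'.edges = N.edges
  mem : m < N'.members.length
  length_le : N.members.length ≤ N'.members.length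
  color : ∀ i < N.members.length, N'.memberColor i = N.memberColor i

theorem isArrival_self {N : Network} {m : ℕ} (hm : m < N.members.length) : N.IsArrival N m :=
  ⟨rfl, rfl, hm, le_rfl, fun _ _ => rfl⟩

theorem isArrival_addMember (N : Network) (c : Color) :
    N.IsArrival (N.addMember c) N.members.length :=
  ⟨rfl, rfl, by simp [addMember], by simp [addMember], fun i hi => by
    simp [addMember, memberColor, List.getElem?_append, hi]⟩

theorem memberColor_addMember (N : Network) (c : Color) :
    (N.addMember c).memberColor N.members.length = c := by
  simp [addMember, memberColor]

/-- The network `y` is a possible outcome of one time step from `N`. -/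
def Growth (N y : Network) : Prop :=
  ∃ N' m, N.IsArrival N' m ∧
    (y = N'.createGroup m ∨ ∃ g < N.groups.length, y = N'.connect m g)

/-- The number of groups of color `c`. -/
def groupCount (N : Network) (c : Color) : ℕ :=
  ((Finset.range N.groups.length).filter fun g => N.groupColor g = c).card

/-- The sum of the degrees of the members of color `c`. -/
def degreeSum (N : Network) (c : Color) : ℕ := N.edges.countP fun e => N.memberColor e.1 = c

section Arrival

variable {N N' : Network} {m : ℕ} (h : N.IsArrival N' m)
include h

theorem IsArrival.groupColor_eq (g : ℕ) : N'.groupColor g = N.groupColor g := by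
  simp only [groupColor, h.groups]

theorem IsArrival.groupSize_eq (g : ℕ) : N'.groupSize g = N.groupSize g := by
  simp only [groupSize, h.edges]

theorem IsArrival.groupColor_createGroup {g : ℕ} (hg : g < N.groups.length) :
    (N'.createGroup m).groupColor g = N.groupColor g := by
  simp [createGroup, connect, groupColor, h.groups, List.getElem?_append, hg]

theorem IsArrival.groupColor_createGroup_length :
    (N'.createGroup m).groupColor N.groups.length = N'.memberColor m := by
  simp [createGroup, connect, groupColor, h.groups]

theorem IsArrival.length_createGroup :
    (N'.createGroup m).groups.length = N.groups.length + 1 := by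
  simp [createGroup, connect, h.groups]

theorem IsArrival.groupSize_createGroup (g : ℕ) : (N'.createGroup m).groupSize g
    = N.groupSize g + if N.groups.length = g then 1 else 0 := by
  simp [createGroup, connect, groupSize, h.edges, h.groups, List.countP_cons]

theorem IsArrival.groupSize_connect (g i : ℕ) : (N'.connect m g).groupSize i
    = N.groupSize i + if g = i then 1 else 0 := by
  simp [connect, groupSize, h.edges, List.countP_cons]

theorem IsArrival.groupColor_connect (g i : ℕ) :
    (N'.connect m g).groupColor i = N.groupColor i := by
  simp [connect, groupColor, h.groups]

theorem IsArrival.length_connect (g : ℕ) :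
    (N'.connect m g).groups.length = N.groups.length := by
  simp [connect, h.groups]

theorem IsArrival.edges_createGroup :
    (N'.createGroup m).edges = (m, N.groups.length) :: N.edges := by
  simp [createGroup, connect, h.edges, h.groups]

theorem IsArrival.edges_connect (g : ℕ) : (N'.connect m g).edges = (m, g) :: N.edges := by
  simp [connect, h.edges]

end Arrival

theorem Valid.groupSize_length {N : Network} (hN : N.Valid) : N.groupSize N.groups.length = 0 := by
  rw [groupSize, List.countP_eq_zero]
  intro e he
  simpa using (hN.edge e he).2.ne

theorem Valid.growth {N y : Network} (hN : N.Valid) (h : N.Growth y) :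
    y.Valid ∧ y.edges.length = N.edges.length + 1 := by
  obtain ⟨N', m, ha, rfl | ⟨g, hg, rfl⟩⟩ := h
  · refine ⟨⟨?_, ?_, ?_⟩, by simp [ha.edges_createGroup]⟩
    · intro e he
      rw [ha.edges_createGroup] at he
      rw [ha.length_createGroup]
      change e.1 < N'.members.length ∧ _
      rcases List.mem_cons.1 he with rfl | he
      · exact ⟨ha.mem, Nat.lt_succ_self _⟩
      · have := hN.edge e he
        have := ha.length_le
        omega
    · intro g hg
      rw [ha.length_createGroup] at hg
      rw [ha.groupSize_createGroup]
      split_ifs with h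
      · omega
      · have := hN.size_pos g (by omega)
        omega
    · intro c
      obtain ⟨g, hg, hc⟩ := hN.exists_color c
      exact ⟨g, by rw [ha.length_createGroup]; omega, by rw [ha.groupColor_createGroup hg, hc]⟩
  · refine ⟨⟨?_, ?_, ?_⟩, by simp [ha.edges_connect]⟩
    · intro e he
      rw [ha.edges_connect] at he
      rw [ha.length_connect]
      change e.1 < N'.members.length ∧ _
      rcases List.mem_cons.1 he with rfl | he
      · exact ⟨ha.mem, hg⟩
      · have := hN.edge e he
        have := ha.length_le
        omega
    · intro i hi
      rw [ha.length_connect] at hi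
      rw [ha.groupSize_connect]
      have := hN.size_pos i hi
      omega
    · intro c
      obtain ⟨i, hi, hc⟩ := hN.exists_color c
      exact ⟨i, by rwa [ha.length_connect], by rw [ha.groupColor_connect, hc]⟩

theorem valid_initial : initial.Valid := by
  refine ⟨?_, ?_, ?_⟩
  · simp [initial]
  · intro g hg
    have : g = 0 ∨ g = 1 := by simp [initial] at hg; omega
    rcases this with rfl | rfl <;> simp [initial, groupSize]
  · intro c
    cases c
    · exact ⟨0, by simp [initial], by simp [initial, groupColor]⟩
    · exact ⟨1, by simp [initial], by simp [initial, groupColor]⟩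

theorem Valid.sum_groupSize {N : Network} (hN : N.Valid) :
    ∑ g ∈ Finset.range N.groups.length, N.groupSize g = N.edges.length := by
  have := sum_range_countP N.edges Prod.snd (fun e he => (hN.edge e he).2) fun _ => True
  simpa [groupSize] using this

theorem Valid.sum_memberDegree {N : Network} (hN : N.Valid) :
    ∑ m ∈ Finset.range N.members.length, N.memberDegree m = N.edges.length := by
  have := sum_range_countP N.edges Prod.fst (fun e he => (hN.edge e he).1) fun _ => True
  simpa [memberDegree] using this

theorem Valid.sizeSum_eq {N : Network} (hN : N.Valid) (c : Color) :
    N.sizeSum c = N.edges.countP fun e => N.groupColor e.2 = c := by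
  rw [← sum_range_countP N.edges Prod.snd (fun e he => (hN.edge e he).2) fun g => N.groupColor g = c,
    sizeSum, Finset.sum_filter]
  rfl

theorem Valid.sum_degree_ite {N : Network} (hN : N.Valid) (c : Color) :
    (∑ m ∈ Finset.range N.members.length, if N.memberColor m = c then N.memberDegree m else 0)
      = N.degreeSum c :=
  sum_range_countP N.edges Prod.fst (fun e he => (hN.edge e he).1) fun m => N.memberColor m = c

theorem Valid.length_groups_pos {N : Network} (hN : N.Valid) : 0 < N.groups.length := by
  obtain ⟨g, hg, -⟩ := hN.exists_color .red
  omega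

theorem Valid.length_edges_pos {N : Network} (hN : N.Valid) : 0 < N.edges.length := by
  have := hN.sum_groupSize ▸ Finset.sum_pos (fun g hg => hN.size_pos g (Finset.mem_range.1 hg))
    (Finset.nonempty_range_iff.2 hN.length_groups_pos.ne')
  simpa using this

theorem Valid.groupCount_pos {N : Network} (hN : N.Valid) (c : Color) : 0 < N.groupCount c := by
  obtain ⟨g, hg, hc⟩ := hN.exists_color c
  exact Finset.card_pos.2 ⟨g, by simp [hg, hc]⟩

theorem sum_groupCount (N : Network) : ∑ c, N.groupCount c = N.groups.length := by
  have := Finset.card_eq_sum_card_fiberwise (f := N.groupColor)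
    (s := Finset.range N.groups.length) (t := Finset.univ) (by simp)
  rw [Finset.card_range] at this
  exact this.symm

theorem Valid.sum_sizeSum {N : Network} (hN : N.Valid) : ∑ c, N.sizeSum c = N.edges.length := by
  rw [← hN.sum_groupSize]
  exact Finset.sum_fiberwise _ _ _

theorem Valid.sizeCount_zero {N : Network} (hN : N.Valid) (c : Color) : N.sizeCount c 0 = 0 := by
  rw [sizeCount, Finset.card_eq_zero, Finset.filter_eq_empty_iff]
  intro g hg
  have := hN.size_pos g (Finset.mem_range.1 hg)
  omega

theorem sizeCount_eq_sum (N : Network) (c : Color) (k : ℕ) :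
    (N.sizeCount c k : ℝ) = ∑ g ∈ Finset.range N.groups.length,
      if N.groupColor g = c ∧ N.groupSize g = k then 1 else 0 := by
  rw [sizeCount, Finset.card_filter]
  push_cast
  rfl

theorem groupCount_eq_sum (N : Network) (c : Color) :
    (N.groupCount c : ℝ) = ∑ g ∈ Finset.range N.groups.length,
      if N.groupColor g = c then 1 else 0 := by
  rw [groupCount, Finset.card_filter]
  push_cast
  rfl

theorem sizeSum_eq_sum (N : Network) (c : Color) :
    (N.sizeSum c : ℝ) = ∑ g ∈ Finset.range N.groups.length,
      if N.groupColor g = c then (N.groupSize g : ℝ) else 0 := by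
  rw [sizeSum, Finset.sum_filter]
  push_cast
  rfl

/-- The statistic `v` of networks changes by `u N c` when a member of color `c` creates a group, and
by `w N c g` when a member of color `c` joins the group `g`. -/
structure HasIncrements (v : Network → ℝ) (u : Network → Color → ℝ)
    (w : Network → Color → ℕ → ℝ) : Prop where
  create : ∀ {N N' : Network} {m : ℕ}, N.Valid → N.IsArrival N' m →
    v (N'.createGroup m) = v N + u N (N'.memberColor m)
  join : ∀ {N N' : Network} {m g : ℕ}, N.Valid → N.IsArrival N' m → g < N.groups.length →
    v (N'.connect m g) = v N + w N (N'.memberColor m) g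
  abs_create_le : ∀ N c, |u N c| ≤ 1
  abs_join_le : ∀ N c g, |w N c g| ≤ 1

theorem abs_ite_le (p : Prop) [Decidable p] : |if p then (1 : ℝ) else 0| ≤ 1 := by
  split_ifs <;> simp

theorem countP_edges_congr {N N' : Network} {m : ℕ} (hN : N.Valid) (h : N.IsArrival N' m)
    (c : Color) : (N.edges.countP fun e => N'.memberColor e.1 = c) = N.degreeSum c :=
  List.countP_congr fun e he => by simp [h.color _ (hN.edge e he).1]

theorem hasIncrements_degreeSum (c : Color) : HasIncrements (fun N => (N.degreeSum c : ℝ))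
    (fun _ m => if m = c then 1 else 0) (fun _ m _ => if m = c then 1 else 0) where
  create {N N' m} hN h := by
    have : (N'.createGroup m).degreeSum c
        = N.degreeSum c + if N'.memberColor m = c then 1 else 0 := by
      rw [degreeSum, h.edges_createGroup, List.countP_cons, ← countP_edges_congr hN h]
      change (N.edges.countP fun e => N'.memberColor e.1 = c)
        + (if decide (N'.memberColor m = c) = true then 1 else 0) = _
      simp
    rw [this]; push_cast; rfl
  join {N N' m g} hN h hg := by
    have : (N'.connect m g).degreeSum c
        = N.degreeSum c + if N'.memberColor m = c then 1 else 0 := by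
      rw [degreeSum, h.edges_connect, List.countP_cons, ← countP_edges_congr hN h]
      change (N.edges.countP fun e => N'.memberColor e.1 = c)
        + (if decide (N'.memberColor m = c) = true then 1 else 0) = _
      simp
    rw [this]; push_cast; rfl
  abs_create_le _ _ := abs_ite_le _
  abs_join_le _ _ _ := abs_ite_le _

theorem hasIncrements_groupCount (c : Color) : HasIncrements (fun N => (N.groupCount c : ℝ))
    (fun _ m => if m = c then 1 else 0) (fun _ _ _ => 0) where
  create {N N' m} hN h := by
    rw [groupCount_eq_sum, groupCount_eq_sum, h.length_createGroup, Finset.sum_range_succ,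
      h.groupColor_createGroup_length]
    congr 1
    exact Finset.sum_congr rfl fun g hg => by
      rw [h.groupColor_createGroup (Finset.mem_range.1 hg)]
  join {N N' m g} hN h hg := by
    simp only [groupCount_eq_sum, h.length_connect, h.groupColor_connect, add_zero]
  abs_create_le _ _ := abs_ite_le _
  abs_join_le _ _ _ := by simp

theorem hasIncrements_sizeSum (c : Color) : HasIncrements (fun N => (N.sizeSum c : ℝ))
    (fun _ m => if m = c then 1 else 0) (fun N _ g => if N.groupColor g = c then 1 else 0) where
  create {N N' m} hN h := by
    rw [sizeSum_eq_sum, sizeSum_eq_sum, h.length_createGroup, Finset.sum_range_succ,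
      h.groupColor_createGroup_length, h.groupSize_createGroup, hN.groupSize_length]
    congr 1
    · refine Finset.sum_congr rfl fun g hg => ?_
      rw [h.groupColor_createGroup (Finset.mem_range.1 hg), h.groupSize_createGroup,
        if_neg (Finset.mem_range.1 hg).ne', add_zero]
    · simp
  join {N N' m g} hN h hg := by
    simp only [sizeSum_eq_sum, h.length_connect, h.groupColor_connect, h.groupSize_connect]
    have : (if N.groupColor g = c then (1 : ℝ) else 0) = ∑ i ∈ Finset.range N.groups.length,
        if g = i then (if N.groupColor i = c then 1 else 0) else 0 := by
      rw [Finset.sum_ite_eq, if_pos (Finset.mem_range.2 hg)]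
    rw [this, ← Finset.sum_add_distrib]
    refine Finset.sum_congr rfl fun i _ => ?_
    split_ifs <;> simp
  abs_create_le _ _ := abs_ite_le _
  abs_join_le _ _ _ := abs_ite_le _

theorem hasIncrements_sizeCount (c : Color) (k : ℕ) :
    HasIncrements (fun N => (N.sizeCount c k : ℝ))
      (fun _ m => if m = c ∧ k = 1 then 1 else 0)
      (fun N _ g => (if N.groupColor g = c ∧ N.groupSize g + 1 = k then 1 else 0)
        - if N.groupColor g = c ∧ N.groupSize g = k then 1 else 0) where
  create {N N' m} hN h := by
    rw [sizeCount_eq_sum, sizeCount_eq_sum, h.length_createGroup, Finset.sum_range_succ,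
      h.groupColor_createGroup_length, h.groupSize_createGroup, hN.groupSize_length]
    congr 1
    · refine Finset.sum_congr rfl fun g hg => ?_
      rw [h.groupColor_createGroup (Finset.mem_range.1 hg), h.groupSize_createGroup,
        if_neg (Finset.mem_range.1 hg).ne', add_zero]
    · simp [eq_comm]
  join {N N' m g} hN h hg := by
    simp only [sizeCount_eq_sum, h.length_connect, h.groupColor_connect, h.groupSize_connect]
    have : ((if N.groupColor g = c ∧ N.groupSize g + 1 = k then (1 : ℝ) else 0)
        - if N.groupColor g = c ∧ N.groupSize g = k then 1 else 0)
        = ∑ i ∈ Finset.range N.groups.length, if g = i then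
          ((if N.groupColor i = c ∧ N.groupSize i + 1 = k then (1 : ℝ) else 0)
            - if N.groupColor i = c ∧ N.groupSize i = k then 1 else 0) else 0 := by
      rw [Finset.sum_ite_eq, if_pos (Finset.mem_range.2 hg)]
    rw [this, ← Finset.sum_add_distrib]
    refine Finset.sum_congr rfl fun i _ => ?_
    by_cases hi : g = i <;> simp [hi]
  abs_create_le _ _ := abs_ite_le _
  abs_join_le N _ g := by
    split_ifs <;> simp

end Network

/-! ### The expected increments -/

/-- The expectation of `w g` over the group `g` that a member of color `m` joins in a single
attempt, where failures count as `0`. -/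
noncomputable def attemptMean (Θ : Params) (N : Network) (m : Color) (w : ℕ → ℝ) : ℝ :=
  Θ.xi * ((∑ g ∈ Finset.range N.groups.length,
      (N.groupSize g : ℝ) * (acceptance Θ.rhoP m (N.groupColor g) * w g)) / N.edges.length)
    + (1 - Θ.xi) * ((∑ g ∈ Finset.range N.groups.length,
      acceptance Θ.rhoU m (N.groupColor g) * w g) / N.groups.length)

theorem expect_consider (N : Network) (rho : Color → ℝ) (m : Color) (g : ℕ) (h0 : 0 ≤ rho m)
    (h1 : rho m ≤ 1) {w : ℕ → ℝ} {C : ℝ} (hw : ∀ g, |w g| ≤ C) :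
    expect (consider N m g (rho m) h0 h1) (fun o => o.elim 0 w)
      = acceptance rho m (N.groupColor g) * w g := by
  have hC : 0 ≤ C := (abs_nonneg _).trans (hw 0)
  unfold consider acceptance
  split_ifs
  · simp [expect_pure]
  · rw [expect_map (C := C) _ _ (fun o => by cases o <;> simp [hw, hC]), expect_coin]
    simp

theorem abs_elim_le {w : ℕ → ℝ} {C : ℝ} (hw : ∀ g, |w g| ≤ C) (o : Option ℕ) :
    |o.elim 0 w| ≤ C := by
  have hC : 0 ≤ C := (abs_nonneg _).trans (hw 0)
  cases o <;> simp [hw, hC]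

theorem expect_attempt (Θ : Params) {N : Network} (hN : N.Valid) (m : Color) {w : ℕ → ℝ} {C : ℝ}
    (hw : ∀ g, |w g| ≤ C) :
    expect (attempt Θ N m) (fun o => o.elim 0 w) = attemptMean Θ N m w := by
  have hb := abs_elim_le hw
  unfold attempt attemptMean
  rw [expect_bind _ _ hb, expect_coin]
  simp only [if_true, Bool.false_eq_true, if_false]
  rw [expect_bind _ _ hb, expect_bind _ _ hb,
    expect_pick _ _ (by rw [hN.sum_groupSize]; exact hN.length_edges_pos.ne'),
    expect_pick _ _ (by simpa using hN.length_groups_pos.ne'), hN.sum_groupSize]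
  simp only [expect_consider N _ m _ _ _ hw]
  simp

theorem expect_groupStep (Θ : Params) {N N' : Network} {m : ℕ} (hN : N.Valid)
    (ha : N.IsArrival N' m) (hpos : 0 < attemptMean Θ N (N'.memberColor m) fun _ => 1)
    {h : Network → ℝ} {C : ℝ} (hh : ∀ y, |h y| ≤ C) :
    expect (groupStep Θ N' m) h = Θ.eta * h (N'.createGroup m) + (1 - Θ.eta) *
      (attemptMean Θ N (N'.memberColor m) (fun g => h (N'.connect m g))
        / attemptMean Θ N (N'.memberColor m) fun _ => 1) := by
  have hat : ∀ c, attempt Θ N' c = attempt Θ N c := fun c => by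
    have e1 : N'.groupSize = N.groupSize := funext ha.groupSize_eq
    unfold attempt consider
    simp only [ha.groups, e1, ha.groupColor_eq]
  have h1 : expect (attempt Θ N (N'.memberColor m)) (fun o => o.elim 0 fun _ => 1)
      = attemptMean Θ N (N'.memberColor m) fun _ => 1 :=
    expect_attempt Θ hN _ (C := 1) (by simp)
  unfold groupStep
  rw [expect_bind _ _ hh, expect_coin]
  simp only [if_true, Bool.false_eq_true, if_false]
  rw [expect_pure, expect_map _ _ hh, hat, expect_untilSuccess _ (by rw [h1]; exact hpos.ne'), h1,
    expect_attempt Θ hN _ fun g => hh _]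

/-- The probability that the member `m*` chosen in a time step has color `c`. -/
noncomputable def memberProb (Θ : Params) (N : Network) (c : Color) : ℝ :=
  Θ.alpha * Θ.colorProb c + (1 - Θ.alpha) * (N.degreeSum c / N.edges.length)

/-- The expectation, over one time step, of a quantity that equals `u c` if a member of color `c`
creates a group and `w c g` if a member of color `c` joins group `g`. -/
noncomputable def stepMean (Θ : Params) (N : Network) (u : Color → ℝ) (w : Color → ℕ → ℝ) : ℝ :=
  ∑ c, memberProb Θ N c * (Θ.eta * u c + (1 - Θ.eta) *
    (attemptMean Θ N c (w c) / attemptMean Θ N c fun _ => 1))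

theorem attemptMean_congr (Θ : Params) {N : Network} (m : Color) {w w' : ℕ → ℝ}
    (h : ∀ g < N.groups.length, w g = w' g) : attemptMean Θ N m w = attemptMean Θ N m w' := by
  unfold attemptMean
  congr 3 <;> refine Finset.sum_congr rfl fun g hg => ?_ <;> rw [h g (Finset.mem_range.1 hg)]

/-- The law of `m*` and of the group it connects to, for quantities that depend only on the color of
`m*` and on the group. -/
theorem expect_step (Θ : Params) {N : Network} (hN : N.Valid)
    (hpos : ∀ c, 0 < attemptMean Θ N c fun _ => 1) {h : Network → ℝ} {C : ℝ}
    (hh : ∀ y, |h y| ≤ C) {u : Color → ℝ} {w : Color → ℕ → ℝ}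
    (hu : ∀ N' m, N.IsArrival N' m → h (N'.createGroup m) = u (N'.memberColor m))
    (hw : ∀ N' m, N.IsArrival N' m → ∀ g < N.groups.length,
      h (N'.connect m g) = w (N'.memberColor m) g) :
    expect (step Θ N) h = stepMean Θ N u w := by
  set s : Color → ℝ := fun c => Θ.eta * u c + (1 - Θ.eta) *
    (attemptMean Θ N c (w c) / attemptMean Θ N c fun _ => 1) with hs
  have key : ∀ N' m, N.IsArrival N' m → expect (groupStep Θ N' m) h = s (N'.memberColor m) :=
    fun N' m ha => by
      rw [expect_groupStep Θ hN ha (hpos _) hh, hu N' m ha,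
        attemptMean_congr Θ _ (hw N' m ha)]
  have hnew : ∀ c, expect (groupStep Θ (N.addMember c) N.members.length) h = s c := fun c => by
    rw [key _ _ (N.isArrival_addMember c), N.memberColor_addMember]
  have hold : ∑ m ∈ Finset.range N.members.length,
      (N.memberDegree m : ℝ) * expect (groupStep Θ N m) h = ∑ c, (N.degreeSum c : ℝ) * s c := by
    have : ∀ c, (N.degreeSum c : ℝ) = ∑ m ∈ Finset.range N.members.length,
        if N.memberColor m = c then (N.memberDegree m : ℝ) else 0 := fun c => by
      rw [← hN.sum_degree_ite c]; push_cast; rfl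
    simp_rw [this, Finset.sum_mul]
    rw [Finset.sum_comm]
    refine Finset.sum_congr rfl fun m hm => ?_
    rw [key _ _ (Network.isArrival_self (Finset.mem_range.1 hm))]
    simp [ite_mul]
  unfold step
  rw [expect_bind _ _ hh, expect_coin]
  simp only [if_true, Bool.false_eq_true, if_false]
  rw [expect_bind _ _ hh, expect_coin, expect_bind _ _ hh,
    expect_pick _ _ (by rw [hN.sum_memberDegree]; exact hN.length_edges_pos.ne'),
    hN.sum_memberDegree, hold]
  simp only [if_true, Bool.false_eq_true, if_false]
  rw [hnew, hnew, stepMean, Color.sum_univ, Color.sum_univ]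
  simp only [memberProb, Params.colorProb, hs]
  ring

/-- The shares of the colors in the total of the group sizes. -/
noncomputable def sizeShare (N : Network) (c : Color) : ℝ := N.sizeSum c / N.edges.length

/-- The shares of the colors in the number of groups. -/
noncomputable def groupShare (N : Network) (c : Color) : ℝ := N.groupCount c / N.groups.length

theorem attemptMean_color (Θ : Params) (N : Network) (m : Color) (φ : Color → ℝ) :
    attemptMean Θ N m (fun g => φ (N.groupColor g))
      = Θ.xi * ∑ c, acceptance Θ.rhoP m c * sizeShare N c * φ c
        + (1 - Θ.xi) * ∑ c, acceptance Θ.rhoU m c * groupShare N c * φ c := by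
  unfold attemptMean sizeShare groupShare
  simp_rw [N.groupCount_eq_sum, N.sizeSum_eq_sum]
  congr 2 <;>
  · rw [Finset.sum_div]
    simp_rw [Finset.sum_div, Finset.mul_sum, Finset.sum_mul]
    rw [Finset.sum_comm]
    refine Finset.sum_congr rfl fun g _ => ?_
    rw [Finset.sum_eq_single (N.groupColor g) (fun c _ hc => by simp [hc.symm]) (by simp)]
    simp only [if_true]
    ring

theorem attemptMean_one (Θ : Params) (N : Network) (m : Color) :
    attemptMean Θ N m (fun _ => 1) = Θ.successProb m (sizeShare N) (groupShare N) := by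
  rw [attemptMean_color Θ N m fun _ => 1]
  simp [Params.successProb]

theorem attemptMean_one_pos (Θ : Params) (hρ : ∀ c, 0 < Θ.rhoP c) {N : Network} (hN : N.Valid)
    (m : Color) : 0 < attemptMean Θ N m fun _ => 1 := by
  rw [attemptMean_one]
  have hE : (0 : ℝ) < N.edges.length := by exact_mod_cast hN.length_edges_pos
  have hK : (0 : ℝ) < N.groups.length := by exact_mod_cast hN.length_groups_pos
  refine Θ.successProb_pos hρ m (fun c => by unfold sizeShare; positivity) ?_ fun c =>
    div_pos (by exact_mod_cast hN.groupCount_pos c) hK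
  unfold sizeShare
  rw [← Finset.sum_div, div_eq_one_iff_eq hE.ne']
  exact_mod_cast hN.sum_sizeSum

theorem attemptMean_sizeCount (Θ : Params) (N : Network) (m c : Color) (k : ℕ) :
    attemptMean Θ N m (fun g => if N.groupColor g = c ∧ N.groupSize g = k then 1 else 0)
      = (Θ.xi * acceptance Θ.rhoP m c * (k / N.edges.length)
        + (1 - Θ.xi) * acceptance Θ.rhoU m c * (1 / N.groups.length)) * N.sizeCount c k := by
  unfold attemptMean
  rw [N.sizeCount_eq_sum, add_mul]
  congr 1
  · rw [show ∑ g ∈ Finset.range N.groups.length, (N.groupSize g : ℝ) *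
        (acceptance Θ.rhoP m (N.groupColor g) *
          if N.groupColor g = c ∧ N.groupSize g = k then 1 else 0)
        = k * acceptance Θ.rhoP m c * ∑ g ∈ Finset.range N.groups.length,
          if N.groupColor g = c ∧ N.groupSize g = k then 1 else 0 by
      rw [Finset.mul_sum]
      refine Finset.sum_congr rfl fun g _ => ?_
      split_ifs with hg
      · rw [hg.1, hg.2]; ring
      · simp]
    ring
  · rw [show ∑ g ∈ Finset.range N.groups.length, acceptance Θ.rhoU m (N.groupColor g) *
          (if N.groupColor g = c ∧ N.groupSize g = k then 1 else 0)
        = acceptance Θ.rhoU m c * ∑ g ∈ Finset.range N.groups.length,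
          if N.groupColor g = c ∧ N.groupSize g = k then 1 else 0 by
      rw [Finset.mul_sum]
      refine Finset.sum_congr rfl fun g _ => ?_
      split_ifs with hg
      · rw [hg.1]
      · simp]
    ring

theorem attemptMean_sub (Θ : Params) (N : Network) (m : Color) (w w' : ℕ → ℝ) :
    attemptMean Θ N m (fun g => w g - w' g) = attemptMean Θ N m w - attemptMean Θ N m w' := by
  unfold attemptMean
  simp only [mul_sub, Finset.sum_sub_distrib, sub_div]
  ring

/-! ### The Markov property -/

instance : Countable Color := Finite.to_countable

instance : Countable Network :=
  Function.Injective.countable (f := fun N : Network => (N.members, N.groups, N.edges))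
    fun N N' h => by
      cases N; cases N'
      simpa using h

instance : DiscreteMeasurableSpace Network := ⟨fun _ => trivial⟩

instance : Nonempty Network := ⟨Network.initial⟩

theorem integral_toMeasure {α : Type*} [MeasurableSpace α] [DiscreteMeasurableSpace α]
    (p : PMF α) {f : α → ℝ} {C : ℝ} (hf : ∀ a, |f a| ≤ C) :
    ∫ a, f a ∂p.toMeasure = expect p f := by
  rw [PMF.integral_eq_tsum p f (.of_bound (Measurable.of_discrete).aestronglyMeasurable C
    (.of_forall hf))]
  rfl

section Chain

variable {Θ : Params} {Ω : Type*} [MeasurableSpace Ω] {P : Measure Ω} {N : ℕ → Ω → Network}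

/-- The first `n + 1` networks, at the times `2, …, n + 2`. -/
def history (N : ℕ → Ω → Network) (n : ℕ) (ω : Ω) : Fin (n + 1) → Network := fun i => N (i + 2) ω

theorem IsGSHM.measurable_history (hN : IsGSHM Θ P N) (n : ℕ) : Measurable (history N n) :=
  measurable_pi_lambda _ fun i => hN.measurable (i + 2) (by omega)

/-- The information about the networks at the times `2, …, n + 2`. -/
def IsGSHM.filtration (hN : IsGSHM Θ P N) : Filtration ℕ ‹MeasurableSpace Ω› where
  seq n := MeasurableSpace.comap (history N n) inferInstance
  mono' n k hnk := by
    have : history N n = (fun x (i : Fin (n + 1)) => x (Fin.castLE (by omega) i)) ∘ history N k := by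
      ext ω i; rfl
    simp only
    rw [this, ← MeasurableSpace.comap_comp]
    exact MeasurableSpace.comap_mono (Measurable.comap_le
      (measurable_pi_lambda _ fun i => measurable_pi_apply _))
  le' n := (hN.measurable_history n).comap_le

theorem IsGSHM.measurable_filtration (hN : IsGSHM Θ P N) {n k : ℕ} (hk : k ≤ n) :
    Measurable[hN.filtration n] (N (k + 2)) :=
  (measurable_pi_apply (⟨k, by omega⟩ : Fin (n + 1))).comp
    (comap_measurable (history N n))

/-- The joint law of the history and the next network, from the probabilities of single paths. -/
theorem IsGSHM.map_history_eq_compProd [IsProbabilityMeasure P] (hN : IsGSHM Θ P N) (n : ℕ) :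
    P.map (fun ω => (history N n ω, N (n + 3) ω)) = P.map (history N n) ⊗ₘ
      (Kernel.ofFunOfCountable fun x : Fin (n + 1) → Network =>
        (step Θ (x (Fin.last n))).toMeasure) := by
  have : IsMarkovKernel (Kernel.ofFunOfCountable fun x : Fin (n + 1) → Network =>
      (step Θ (x (Fin.last n))).toMeasure) := ⟨fun x => PMF.toMeasure.isProbabilityMeasure _⟩
  have hm := hN.measurable_history n
  refine Measure.ext_of_singleton fun ⟨x, y⟩ => ?_
  rw [Measure.map_apply (hm.prodMk (hN.measurable (n + 3) (by omega))) .of_discrete,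
    ← Set.singleton_prod_singleton, Measure.compProd_apply_prod .of_discrete .of_discrete,
    lintegral_singleton, Measure.map_apply hm .of_discrete]
  -- the path that has the history `x` and continues with `y`
  set z : ℕ → Network := fun j => if h : j - 2 < n + 1 then x ⟨j - 2, h⟩ else y with hz
  have hzx : ∀ i : Fin (n + 1), z (i + 2) = x i := fun i => by
    simp only [hz, Nat.add_sub_cancel, i.2, dif_pos]
  have hzy : z (n + 3) = y := by
    simp only [hz]
    rw [dif_neg (by omega)]
  have hpast : {ω | ∀ i, 2 ≤ i → i ≤ n + 2 → N i ω = z i} = history N n ⁻¹' {x} := by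
    ext ω
    simp only [Set.mem_ofPred_eq, Set.mem_preimage, Set.mem_singleton_iff, funext_iff, history]
    refine ⟨fun h i => by rw [h _ (by omega) (by omega), hzx], fun h i hi hin => ?_⟩
    obtain ⟨j, rfl⟩ : ∃ j, i = j + 2 := ⟨i - 2, by omega⟩
    exact (h ⟨j, by omega⟩).trans (hzx ⟨j, by omega⟩).symm
  have hfut : {ω | ∀ i, 2 ≤ i → i ≤ n + 2 + 1 → N i ω = z i}
      = (fun ω => (history N n ω, N (n + 3) ω)) ⁻¹' ({x} ×ˢ {y}) := by
    have : {ω | ∀ i, 2 ≤ i → i ≤ n + 2 + 1 → N i ω = z i}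
        = {ω | ∀ i, 2 ≤ i → i ≤ n + 2 → N i ω = z i} ∩ {ω | N (n + 3) ω = y} := by
      ext ω
      refine ⟨fun h => ⟨fun i hi hin => h i hi (by omega),
        (h (n + 3) (by omega) (by omega)).trans hzy⟩, fun h i hi hin => ?_⟩
      rcases Nat.lt_or_ge i (n + 3) with h' | h'
      · exact h.1 i hi (by omega)
      · obtain rfl : i = n + 3 := by omega
        exact h.2.trans hzy.symm
    rw [this, hpast]
    rfl
  have h := hN.markov (n + 2) (by omega) z
  rw [hfut, hpast, hzy] at h
  rw [h, mul_comm]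
  have hlast : z (n + 2) = x (Fin.last n) := hzx (Fin.last n)
  rw [hlast]
  congr 1
  exact (PMF.toMeasure_apply_singleton _ _ .of_discrete).symm

/-- The Markov property for bounded functions of two consecutive networks. -/
theorem IsGSHM.condExp_eq [IsProbabilityMeasure P] (hN : IsGSHM Θ P N) (n : ℕ)
    {g : Network → Network → ℝ} {C : ℝ} (hg : ∀ x y, |g x y| ≤ C) :
    P[fun ω => g (N (n + 2) ω) (N (n + 3) ω) | hN.filtration n]
      =ᵐ[P] fun ω => expect (step Θ (N (n + 2) ω)) (g (N (n + 2) ω)) := by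
  have hm := hN.measurable_history n
  have hm' := hN.measurable (n + 3) (by omega)
  have : IsMarkovKernel (Kernel.ofFunOfCountable fun x : Fin (n + 1) → Network =>
      (step Θ (x (Fin.last n))).toMeasure) := ⟨fun x => PMF.toMeasure.isProbabilityMeasure _⟩
  have h1 := condDistrib_ae_eq_of_measure_eq_compProd (history N n) hm'.aemeasurable
    (hN.map_history_eq_compProd n)
  have h2 := condExp_prod_ae_eq_integral_condDistrib (μ := P) (X := history N n) (Y := N (n + 3))
    (f := fun p : (Fin (n + 1) → Network) × Network => g (p.1 (Fin.last n)) p.2) hm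
    hm'.aemeasurable (Measurable.of_discrete).stronglyMeasurable
    (.of_bound ((Measurable.of_discrete (f := fun p : (Fin (n + 1) → Network) × Network =>
      g (p.1 (Fin.last n)) p.2)).comp (hm.prodMk hm')).aestronglyMeasurable C
      (.of_forall fun ω => hg _ _))
  filter_upwards [h2, ae_of_ae_map hm.aemeasurable h1] with ω h2 h1
  rw [← integral_toMeasure _ (hg _)]
  refine h2.trans ?_
  rw [h1]
  rfl

theorem IsGSHM.ae_growth_of_valid [IsProbabilityMeasure P] (hN : IsGSHM Θ P N)
    (hρ : ∀ c, 0 < Θ.rhoP c) (n : ℕ) (hv : ∀ᵐ ω ∂P, (N (n + 2) ω).Valid) :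
    ∀ᵐ ω ∂P, (N (n + 2) ω).Growth (N (n + 3) ω) := by
  classical
  set g : Network → Network → ℝ := fun x y => if x.Growth y then 0 else 1 with hg
  have hg1 : ∀ x y, |g x y| ≤ 1 := fun x y => by simp only [hg]; split_ifs <;> simp
  have hm : Measurable fun ω => g (N (n + 2) ω) (N (n + 3) ω) :=
    (Measurable.of_discrete (f := Function.uncurry g)).comp
      ((hN.measurable (n + 2) (by omega)).prodMk (hN.measurable (n + 3) (by omega)))
  have h0 : ∫ ω, g (N (n + 2) ω) (N (n + 3) ω) ∂P = 0 := by
    rw [← integral_condExp (hN.filtration.le n)]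
    rw [integral_congr_ae (g := fun _ => 0)]
    · simp
    filter_upwards [hN.condExp_eq n hg1, hv] with ω h1 h2
    rw [h1, expect_step Θ h2 (attemptMean_one_pos Θ hρ h2) (hg1 _) (u := fun _ => 0)
      (w := fun _ _ => 0)]
    · simp [stepMean, attemptMean]
    · exact fun N' m ha => if_pos ⟨N', m, ha, .inl rfl⟩
    · exact fun N' m ha g hg => if_pos ⟨N', m, ha, .inr ⟨g, hg, rfl⟩⟩
  rw [integral_eq_zero_iff_of_nonneg (fun ω => by simp only [hg, Pi.zero_apply]; split_ifs <;> simp)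
    (.of_bound hm.aestronglyMeasurable 1 (.of_forall fun ω => hg1 _ _))] at h0
  filter_upwards [h0] with ω h
  by_contra hcon
  simp [hg, hcon] at h

theorem IsGSHM.ae_growth [IsProbabilityMeasure P] (hN : IsGSHM Θ P N)
    (hρ : ∀ c, 0 < Θ.rhoP c) : ∀ᵐ ω ∂P, ∀ n, (N (n + 2) ω).Valid ∧
      (N (n + 2) ω).edges.length = n + 2 ∧ (N (n + 2) ω).Growth (N (n + 3) ω) := by
  have h : ∀ n, ∀ᵐ ω ∂P, (N (n + 2) ω).Valid ∧ (N (n + 2) ω).edges.length = n + 2 := by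
    intro n
    induction n with
    | zero =>
      filter_upwards [hN.start] with ω h
      rw [h]
      exact ⟨Network.valid_initial, rfl⟩
    | succ n ih =>
      filter_upwards [ih, hN.ae_growth_of_valid hρ n (ih.mono fun ω h => h.1)] with ω h1 h2
      obtain ⟨h3, h4⟩ := h1.1.growth h2
      exact ⟨h3, by rw [h4, h1.2]⟩
  rw [ae_all_iff]
  intro n
  filter_upwards [h n, hN.ae_growth_of_valid hρ n ((h n).mono fun ω h => h.1)] with ω h1 h2
  exact ⟨h1.1, h1.2, h2⟩

theorem abs_max_min_le (x : ℝ) : |max (-1) (min 1 x)| ≤ 1 :=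
  abs_le.2 ⟨le_max_left _ _, max_le (by norm_num) (min_le_left _ _)⟩

theorem max_min_eq_self {x : ℝ} (h : |x| ≤ 1) : max (-1) (min 1 x) = x := by
  rw [min_eq_right (abs_le.1 h).2, max_eq_right (abs_le.1 h).1]

/-- Doob decomposition: the statistic `v` grows by its conditional mean increment plus a noise term
which, weighted with the step sizes of the stochastic approximation, is summable. -/
theorem IsGSHM.ae_exists_noise [IsProbabilityMeasure P] (hN : IsGSHM Θ P N)
    (hρ : ∀ c, 0 < Θ.rhoP c) {v : Network → ℝ} {u : Network → Color → ℝ}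
    {w : Network → Color → ℕ → ℝ} (hv : Network.HasIncrements v u w) :
    ∀ᵐ ω ∂P, ∃ (ξ : ℕ → ℝ) (l : ℝ),
      (∀ n, v (N (n + 3) ω) = v (N (n + 2) ω)
        + stepMean Θ (N (n + 2) ω) (u (N (n + 2) ω)) (w (N (n + 2) ω)) + ξ n) ∧
      Tendsto (fun n => ∑ i ∈ Finset.range n, 1 / ((i : ℝ) + 3) * ξ i) atTop (𝓝 l) := by
  -- the increments of `v`, truncated so that they are bounded on all pairs of networks
  set g : Network → Network → ℝ := fun x y => max (-1) (min 1 (v y - v x)) with hg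
  have hg1 : ∀ x y, |g x y| ≤ 1 := fun x y => abs_max_min_le _
  set e : Network → ℝ := fun x => expect (step Θ x) (g x) with he
  have he1 : ∀ x, |e x| ≤ 1 := fun x => abs_expect_le _ (hg1 x)
  set ξ : ℕ → Ω → ℝ := fun n ω => g (N (n + 2) ω) (N (n + 3) ω) - e (N (n + 2) ω) with hξ
  have hmg : ∀ n, Measurable[hN.filtration (n + 1)] fun ω => g (N (n + 2) ω) (N (n + 3) ω) :=
    fun n => (Measurable.of_discrete (f := Function.uncurry g)).comp
      ((hN.measurable_filtration (Nat.le_succ n)).prodMk (hN.measurable_filtration le_rfl))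
  have hme : ∀ n, Measurable[hN.filtration n] fun ω => e (N (n + 2) ω) := fun n =>
    (Measurable.of_discrete (f := e)).comp (hN.measurable_filtration le_rfl)
  have hconv := ae_exists_tendsto_sum_mul_of_condExp_eq_zero (P := P) hN.filtration (ξ := ξ) (C := 2)
    (fun n => ((hmg n).sub
      ((hme n).mono (hN.filtration.mono (Nat.le_succ n)) le_rfl)).stronglyMeasurable)
    (fun n ω => (abs_sub _ _).trans (by
      linarith [hg1 (N (n + 2) ω) (N (n + 3) ω), he1 (N (n + 2) ω)]))
    (fun n => ?_) (γ := fun i => 1 / ((i : ℝ) + 3)) ?_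
  · filter_upwards [hconv, hN.ae_growth hρ] with ω ⟨l, hl⟩ hω
    refine ⟨fun n => ξ n ω, l, fun n => ?_, hl⟩
    obtain ⟨hval, -, N', m, ha, hy⟩ := hω n
    have hstep : e (N (n + 2) ω) = stepMean Θ (N (n + 2) ω) (u (N (n + 2) ω)) (w (N (n + 2) ω)) := by
      refine expect_step Θ hval (attemptMean_one_pos Θ hρ hval) (hg1 _) ?_ ?_
      · intro N' m ha
        simp only [hg]
        rw [hv.create hval ha, add_sub_cancel_left, max_min_eq_self (hv.abs_create_le _ _)]
      · intro N' m ha g' hg'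
        simp only [hg]
        rw [hv.join hval ha hg', add_sub_cancel_left, max_min_eq_self (hv.abs_join_le _ _ _)]
    have hinc : g (N (n + 2) ω) (N (n + 3) ω) = v (N (n + 3) ω) - v (N (n + 2) ω) := by
      refine max_min_eq_self ?_
      rcases hy with hy | ⟨g', hg', hy⟩
      · rw [hy, hv.create hval ha, add_sub_cancel_left]
        exact hv.abs_create_le _ _
      · rw [hy, hv.join hval ha hg', add_sub_cancel_left]
        exact hv.abs_join_le _ _ _
    simp only [hξ]
    rw [← hstep, hinc]
    ring
  · have hig : Integrable (fun ω => g (N (n + 2) ω) (N (n + 3) ω)) P :=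
      .of_bound ((hmg n).mono (hN.filtration.le _) le_rfl).aestronglyMeasurable 1
        (.of_forall fun ω => hg1 _ _)
    have hie : Integrable (fun ω => e (N (n + 2) ω)) P :=
      .of_bound ((hme n).mono (hN.filtration.le _) le_rfl).aestronglyMeasurable 1
        (.of_forall fun ω => he1 _)
    have h1 := condExp_sub hig hie (hN.filtration n)
    have h2 := condExp_of_stronglyMeasurable (hN.filtration.le n) (hme n).stronglyMeasurable hie
    filter_upwards [h1, hN.condExp_eq n hg1] with ω h1 h3
    refine h1.trans ?_
    rw [Pi.sub_apply, h3, h2]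
    simp [he]
  · have := (summable_nat_add_iff 3).2 (Real.summable_one_div_nat_pow.2 (le_refl 2))
    refine this.congr fun n => ?_
    push_cast
    rw [one_div_pow]

end Chain

/-! ### Almost sure limits of the statistics -/

theorem attemptMean_const (Θ : Params) (N : Network) (m : Color) (b : ℝ) :
    attemptMean Θ N m (fun _ => b) = b * attemptMean Θ N m fun _ => 1 := by
  unfold attemptMean
  simp only [← mul_assoc, ← Finset.sum_mul, mul_one]
  ring

/-- The probability that a red group gains the next connection, when `x` is the red share in the
total of the group sizes, `p.1` are the probabilities of the colors of the member `m*`, and `p.2`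
are the shares of the colors in the number of groups. -/
noncomputable def redGainProb (Θ : Params) (p : (Color → ℝ) × (Color → ℝ)) (x : ℝ) : ℝ :=
  ∑ m, p.1 m * (Θ.eta * (if m = .red then 1 else 0) + (1 - Θ.eta) *
    ((Θ.xi * (acceptance Θ.rhoP m .red * x) + (1 - Θ.xi) * (acceptance Θ.rhoU m .red * p.2 .red))
      / Θ.successProb m (share x) p.2))

theorem redGainProb_colorProb (Θ : Params) (x : ℝ) :
    redGainProb Θ (Θ.colorProb, Θ.colorProb) x = Θ.shareMap x := by
  rw [Θ.shareMap_eq, redGainProb]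
  refine Finset.sum_congr rfl fun m _ => ?_
  simp only [Params.colorProb]
  ring

theorem continuousOn_redGainProb (Θ : Params) (hρ : ∀ c, 0 < Θ.rhoP c) :
    ContinuousOn (redGainProb Θ).uncurry ({p | ∀ c, 0 < p.2 c} ×ˢ Set.Icc 0 1) := by
  unfold redGainProb Function.uncurry
  refine continuousOn_finsetSum _ fun m _ => ContinuousOn.mul (by fun_prop)
    (ContinuousOn.add (by fun_prop) (ContinuousOn.mul (by fun_prop) (ContinuousOn.div (by fun_prop)
      ?_ ?_)))
  · simp only [Params.successProb, Color.sum_univ, share]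
    fun_prop
  · rintro ⟨p, x⟩ ⟨hp, hx⟩
    refine (Θ.successProb_pos hρ m (fun c => ?_) ?_ hp).ne'
    · cases c <;> simp [share, hx.1, hx.2]
    · rw [Color.sum_univ]; simp [share]

/-- The convergence is uniform in the red share `x`, which is not yet known to converge. -/
theorem tendsto_redGainProb_sub (Θ : Params) (hρ : ∀ c, 0 < Θ.rhoP c) {q z : ℕ → Color → ℝ}
    {x : ℕ → ℝ} (hq : ∀ c, Tendsto (fun n => q n c) atTop (𝓝 (Θ.colorProb c)))
    (hz : ∀ c, Tendsto (fun n => z n c) atTop (𝓝 (Θ.colorProb c))) (hz0 : ∀ n c, 0 < z n c)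
    (hx : ∀ n, x n ∈ Set.Icc (0 : ℝ) 1) :
    Tendsto (fun n => redGainProb Θ (q n, z n) (x n) - Θ.shareMap (x n)) atTop (𝓝 0) := by
  have hlim : Tendsto (fun n => (q n, z n)) atTop
      (𝓝[{p | ∀ c, 0 < p.2 c}] (Θ.colorProb, Θ.colorProb)) :=
    tendsto_nhdsWithin_iff.2 ⟨(tendsto_pi_nhds.2 hq).prodMk_nhds (tendsto_pi_nhds.2 hz),
      .of_forall fun n => hz0 n⟩
  rw [Metric.tendsto_nhds]
  intro ε hε
  obtain ⟨s, hs, hs'⟩ := isCompact_Icc.mem_uniformity_of_prod (continuousOn_redGainProb Θ hρ)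
    (q := (Θ.colorProb, Θ.colorProb)) Θ.colorProb_pos (Metric.dist_mem_uniformity hε)
  filter_upwards [hlim hs] with n hn
  have := hs' _ hn _ (hx n)
  rw [redGainProb_colorProb] at this
  simpa [Real.dist_eq] using this

/-- The rate, relative to the number of groups of color `c` and size `k` per time step, at which
such groups gain connections: for `q m`, `d m` the probability and the success probability of
members of color `m`, and `s` the number of time steps per group. -/
noncomputable def gainRate (Θ : Params) (c : Color) (q d : Color → ℝ) (s k : ℝ) : ℝ :=
  ∑ m, q m * ((1 - Θ.eta) * ((Θ.xi * acceptance Θ.rhoP m c * k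
    + (1 - Θ.xi) * acceptance Θ.rhoU m c * s) / d m))

/-- The constants `C1` and `C2` are the coefficients of the limiting gain rate. -/
theorem gainRate_limit (Θ : Params) (a : ℝ) (c : Color) (k : ℝ) :
    gainRate Θ c Θ.colorProb (fun m => Θ.successProb m (share a) Θ.colorProb) (1 / Θ.eta) k
      = k * Θ.C1 a c + Θ.C2 a c := by
  rw [Θ.C1_eq, Θ.C2_eq, gainRate, Finset.mul_sum, ← Finset.sum_add_distrib]
  exact Finset.sum_congr rfl fun m _ => by ring

theorem stepMean_sizeSum (Θ : Params) {N : Network} (hN : N.Valid) :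
    stepMean Θ N (fun m => if m = .red then 1 else 0)
      (fun _ g => if N.groupColor g = .red then 1 else 0)
      = redGainProb Θ (memberProb Θ N, groupShare N) (sizeShare N .red) := by
  have hE : (N.edges.length : ℝ) ≠ 0 := by exact_mod_cast hN.length_edges_pos.ne'
  have hshare : share (sizeShare N .red) = sizeShare N := by
    have h : (N.sizeSum .red : ℝ) + N.sizeSum .blue = N.edges.length := by
      exact_mod_cast Color.sum_univ N.sizeSum ▸ hN.sum_sizeSum
    funext c
    cases c
    · rfl
    · simp only [share, sizeShare, ← h] at hE ⊢
      field_simp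
      ring
  unfold stepMean redGainProb
  refine Finset.sum_congr rfl fun m _ => ?_
  rw [attemptMean_color Θ N m fun c => if c = .red then 1 else 0, attemptMean_one, hshare]
  simp

theorem stepMean_sizeCount (Θ : Params) {N : Network} (hN : N.Valid) (c : Color) (j : ℕ) :
    stepMean Θ N (fun m => if m = c ∧ j + 1 = 1 then 1 else 0)
      (fun _ g => (if N.groupColor g = c ∧ N.groupSize g + 1 = j + 1 then 1 else 0)
        - if N.groupColor g = c ∧ N.groupSize g = j + 1 then 1 else 0)
      = Θ.eta * (if j = 0 then memberProb Θ N c else 0)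
        + gainRate Θ c (memberProb Θ N) (fun m => Θ.successProb m (sizeShare N) (groupShare N))
            (N.edges.length / N.groups.length) j * (N.sizeCount c j / N.edges.length)
        - gainRate Θ c (memberProb Θ N) (fun m => Θ.successProb m (sizeShare N) (groupShare N))
            (N.edges.length / N.groups.length) (j + 1 : ℕ)
          * (N.sizeCount c (j + 1) / N.edges.length) := by
  have hE : (N.edges.length : ℝ) ≠ 0 := by exact_mod_cast hN.length_edges_pos.ne'
  have hK : (N.groups.length : ℝ) ≠ 0 := by exact_mod_cast hN.length_groups_pos.ne'
  have h1 : (if j = 0 then memberProb Θ N c else 0)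
      = ∑ m, memberProb Θ N m * if m = c ∧ j + 1 = 1 then 1 else 0 := by
    by_cases hj : j = 0 <;> simp [hj]
  unfold stepMean gainRate
  rw [h1, Finset.mul_sum, Finset.sum_mul, Finset.sum_mul, ← Finset.sum_add_distrib,
    ← Finset.sum_sub_distrib]
  refine Finset.sum_congr rfl fun m _ => ?_
  rw [attemptMean_sub Θ N m, attemptMean_one]
  simp only [Nat.add_right_cancel_iff]
  rw [attemptMean_sizeCount, attemptMean_sizeCount]
  generalize Θ.successProb m (sizeShare N) (groupShare N) = d
  field_simp
  ring

section Chain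

variable {Θ : Params} {Ω : Type*} [MeasurableSpace Ω] {P : Measure Ω} [IsProbabilityMeasure P]
  {N : ℕ → Ω → Network}

theorem IsGSHM.ae_le (hN : IsGSHM Θ P N) (hρ : ∀ c, 0 < Θ.rhoP c) {v : Network → ℝ}
    {u : Network → Color → ℝ} {w : Network → Color → ℕ → ℝ} (hv : Network.HasIncrements v u w)
    (hv2 : v Network.initial ≤ 2) : ∀ᵐ ω ∂P, ∀ n : ℕ, v (N (n + 2) ω) ≤ n + 2 := by
  filter_upwards [hN.ae_growth hρ, hN.start] with ω hω h0 n
  induction n with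
  | zero => simpa [h0] using hv2
  | succ n ih =>
    obtain ⟨hval, -, N', m, ha, hy⟩ := hω n
    push_cast
    rw [show n + 1 + 2 = n + 3 by ring]
    rcases hy with hy | ⟨g, hg, hy⟩
    · rw [hy, hv.create hval ha]
      linarith [(abs_le.1 (hv.abs_create_le (N (n + 2) ω) (N'.memberColor m))).2]
    · rw [hy, hv.join hval ha hg]
      linarith [(abs_le.1 (hv.abs_join_le (N (n + 2) ω) (N'.memberColor m) g)).2]

/-- The law of large numbers for a statistic `v` of the network whose mean increment is
asymptotically a function `f` of its value per time step. -/
theorem IsGSHM.ae_tendsto_div (hN : IsGSHM Θ P N) (hρ : ∀ c, 0 < Θ.rhoP c) {v : Network → ℝ}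
    {u : Network → Color → ℝ} {w : Network → Color → ℕ → ℝ} (hv : Network.HasIncrements v u w)
    (hv0 : ∀ x, 0 ≤ v x) (hv2 : v Network.initial ≤ 2) {f : ℝ → ℝ} {a : ℝ}
    (hf : ContinuousOn f (Set.Icc 0 1)) (hlt : ∀ x ∈ Set.Icc (0 : ℝ) 1, x < a → x < f x)
    (hgt : ∀ x ∈ Set.Icc (0 : ℝ) 1, a < x → f x < x)
    (hd : ∀ᵐ ω ∂P, Tendsto (fun n : ℕ => stepMean Θ (N (n + 2) ω) (u (N (n + 2) ω))
      (w (N (n + 2) ω)) - f (v (N (n + 2) ω) / (n + 2))) atTop (𝓝 0)) :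
    ∀ᵐ ω ∂P, Tendsto (fun n : ℕ => v (N (n + 2) ω) / (n + 2)) atTop (𝓝 a) := by
  filter_upwards [hN.ae_exists_noise hρ hv, hN.ae_le hρ hv hv2, hd] with ω ⟨ξ, l, h1, h2⟩ hle hd
  exact tendsto_ratio_of_drift (V := fun n => v (N (n + 2) ω)) h1 (fun n => hv0 _) hle h2 hf hd
    hlt hgt

theorem IsGSHM.ae_tendsto_div_of_linear (hN : IsGSHM Θ P N) (hρ : ∀ c, 0 < Θ.rhoP c)
    {v : Network → ℝ} {u : Network → Color → ℝ} {w : Network → Color → ℕ → ℝ}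
    (hv : Network.HasIncrements v u w) (hv0 : ∀ x, 0 ≤ v x) (hv2 : v Network.initial ≤ 2)
    {p κ : ℝ} (hκ : 0 < 1 + κ)
    (hd : ∀ᵐ ω ∂P, Tendsto (fun n : ℕ => stepMean Θ (N (n + 2) ω) (u (N (n + 2) ω))
      (w (N (n + 2) ω)) - (p - κ * (v (N (n + 2) ω) / (n + 2)))) atTop (𝓝 0)) :
    ∀ᵐ ω ∂P, Tendsto (fun n : ℕ => v (N (n + 2) ω) / (n + 2)) atTop (𝓝 (p / (1 + κ))) := by
  refine hN.ae_tendsto_div hρ hv hv0 hv2 (f := fun x => p - κ * x) (by fun_prop) ?_ ?_ hd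
  · intro x _ hx
    rw [lt_div_iff₀ hκ] at hx
    linarith
  · intro x _ hx
    rw [div_lt_iff₀ hκ] at hx
    linarith

theorem stepMean_const_join (hρ : ∀ c, 0 < Θ.rhoP c) {x : Network} (hx : x.Valid)
    (u b : Color → ℝ) : stepMean Θ x u (fun m _ => b m)
      = ∑ m, memberProb Θ x m * (Θ.eta * u m + (1 - Θ.eta) * b m) := by
  unfold stepMean
  refine Finset.sum_congr rfl fun m _ => ?_
  rw [attemptMean_const, mul_div_cancel_right₀ _ (attemptMean_one_pos Θ hρ hx m).ne']

theorem IsGSHM.ae_tendsto_memberProb (hN : IsGSHM Θ P N) (hρ : ∀ c, 0 < Θ.rhoP c) (c : Color) :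
    ∀ᵐ ω ∂P, Tendsto (fun n : ℕ => memberProb Θ (N (n + 2) ω) c) atTop (𝓝 (Θ.colorProb c)) := by
  have h := hN.ae_tendsto_div_of_linear hρ (Network.hasIncrements_degreeSum c)
    (fun x => by positivity) (by
      have : Network.initial.degreeSum c ≤ Network.initial.edges.length := List.countP_le_length
      exact_mod_cast this)
    (p := Θ.alpha * Θ.colorProb c) (κ := -(1 - Θ.alpha)) (by linarith [Θ.alpha_pos]) (by
      filter_upwards [hN.ae_growth hρ] with ω hω
      refine tendsto_const_nhds.congr fun n => ?_
      rw [stepMean_const_join hρ (hω n).1]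
      have : ∀ m : Color, Θ.eta * (if m = c then 1 else 0) + (1 - Θ.eta) * (if m = c then 1 else 0)
          = if m = c then (1 : ℝ) else 0 := fun m => by ring
      simp only [this]
      simp only [mul_ite, mul_one, mul_zero, Finset.sum_ite_eq', Finset.mem_univ, if_true,
        memberProb, (hω n).2.1]
      push_cast
      ring)
  filter_upwards [h, hN.ae_growth hρ] with ω hω h2
  have hα := Θ.alpha_pos.ne'
  rw [show Θ.alpha * Θ.colorProb c / (1 + -(1 - Θ.alpha)) = Θ.colorProb c by
    rw [show 1 + -(1 - Θ.alpha) = Θ.alpha by ring, mul_div_cancel_left₀ _ hα]] at hω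
  have := (hω.const_mul (1 - Θ.alpha)).const_add (Θ.alpha * Θ.colorProb c)
  rw [show Θ.alpha * Θ.colorProb c + (1 - Θ.alpha) * Θ.colorProb c = Θ.colorProb c by ring] at this
  refine this.congr fun n => ?_
  simp only [memberProb, (h2 n).2.1]
  push_cast
  rfl

theorem IsGSHM.ae_tendsto_groupCount (hN : IsGSHM Θ P N) (hρ : ∀ c, 0 < Θ.rhoP c) (c : Color) :
    ∀ᵐ ω ∂P, Tendsto (fun n : ℕ => ((N (n + 2) ω).groupCount c : ℝ) / (n + 2)) atTop
      (𝓝 (Θ.eta * Θ.colorProb c)) := by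
  have h := hN.ae_tendsto_div_of_linear hρ (Network.hasIncrements_groupCount c)
    (fun x => by positivity) (by
      have : Network.initial.groupCount c ≤ _ := Finset.card_filter_le _ _
      rw [Finset.card_range] at this
      exact_mod_cast this)
    (p := Θ.eta * Θ.colorProb c) (κ := 0) (by norm_num) (by
      filter_upwards [hN.ae_growth hρ, hN.ae_tendsto_memberProb hρ c] with ω hω h
      have h' := (h.const_mul Θ.eta).sub_const (Θ.eta * Θ.colorProb c)
      rw [sub_self] at h'
      refine h'.congr fun n => ?_
      rw [stepMean_const_join hρ (hω n).1]
      simp [mul_comm])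
  simpa using h

theorem IsGSHM.ae_tendsto_groups (hN : IsGSHM Θ P N) (hρ : ∀ c, 0 < Θ.rhoP c) :
    ∀ᵐ ω ∂P, Tendsto (fun n : ℕ => ((n : ℝ) + 2) / (N (n + 2) ω).groups.length) atTop
        (𝓝 (1 / Θ.eta)) ∧
      ∀ c, Tendsto (fun n : ℕ => groupShare (N (n + 2) ω) c) atTop (𝓝 (Θ.colorProb c)) := by
  filter_upwards [ae_all_iff.2 (hN.ae_tendsto_groupCount hρ)] with ω h
  have hsum : Tendsto (fun n : ℕ => ((N (n + 2) ω).groups.length : ℝ) / (n + 2)) atTop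
      (𝓝 Θ.eta) := by
    have := tendsto_finsetSum Finset.univ fun c _ => h c
    rw [← Finset.mul_sum, Θ.sum_colorProb, mul_one] at this
    refine this.congr fun n => ?_
    rw [← Finset.sum_div, ← (N (n + 2) ω).sum_groupCount]
    push_cast
    rfl
  refine ⟨?_, fun c => ?_⟩
  · simpa [inv_div] using hsum.inv₀ Θ.eta_pos.ne'
  · have := (h c).div hsum Θ.eta_pos.ne'
    rw [mul_div_cancel_left₀ _ Θ.eta_pos.ne'] at this
    refine this.congr fun n => ?_
    rw [Pi.div_apply, div_div_div_cancel_right₀ (by positivity)]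
    rfl

theorem IsGSHM.ae_tendsto_sizeSum (hN : IsGSHM Θ P N) (hρ : ∀ c, 0 < Θ.rhoP c) {a : ℝ}
    (hlt : ∀ x ∈ Set.Icc (0 : ℝ) 1, x < a → x < Θ.shareMap x)
    (hgt : ∀ x ∈ Set.Icc (0 : ℝ) 1, a < x → Θ.shareMap x < x) :
    ∀ᵐ ω ∂P, Tendsto (fun n : ℕ => ((N (n + 2) ω).sizeSum .red : ℝ) / (n + 2)) atTop (𝓝 a) := by
  have hv2 : (Network.initial.sizeSum .red : ℝ) ≤ 2 := by
    have : Network.initial.sizeSum .red ≤ Network.initial.edges.length := by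
      rw [Network.valid_initial.sizeSum_eq]
      exact List.countP_le_length
    exact_mod_cast this
  refine hN.ae_tendsto_div hρ (Network.hasIncrements_sizeSum .red) (fun x => by positivity) hv2
    (Θ.continuousOn_shareMap hρ) hlt hgt ?_
  filter_upwards [hN.ae_growth hρ, ae_all_iff.2 (hN.ae_tendsto_memberProb hρ),
    hN.ae_tendsto_groups hρ, hN.ae_le hρ (Network.hasIncrements_sizeSum .red) hv2]
    with ω hω hq hz hle
  refine (tendsto_redGainProb_sub Θ hρ hq hz.2 (fun n c => ?_)
    (x := fun n => ((N (n + 2) ω).sizeSum .red : ℝ) / (n + 2)) fun n =>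
      ⟨by positivity, (div_le_one (by positivity)).2 (hle n)⟩).congr fun n => ?_
  · exact div_pos (by exact_mod_cast (hω n).1.groupCount_pos c)
      (by exact_mod_cast (hω n).1.length_groups_pos)
  · rw [stepMean_sizeSum Θ (hω n).1, sizeShare, (hω n).2.1]
    push_cast
    rfl

/-- The limiting number per time step of groups of color `c` and size `k`. -/
noncomputable def limitCount (Θ : Params) (a : ℝ) (c : Color) : ℕ → ℝ
  | 0 => 0
  | k + 1 => (Θ.eta * (if k = 0 then Θ.colorProb c else 0)
      + (k * Θ.C1 a c + Θ.C2 a c) * limitCount Θ a c k) / (1 + ((k + 1 : ℕ) * Θ.C1 a c + Θ.C2 a c))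

theorem sizeCount_initial_le (c : Color) (k : ℕ) : (Network.initial.sizeCount c k : ℝ) ≤ 2 := by
  have : Network.initial.sizeCount c k ≤ _ := Finset.card_filter_le _ _
  rw [Finset.card_range] at this
  exact_mod_cast this

theorem IsGSHM.ae_tendsto_sizeShare (hN : IsGSHM Θ P N) (hρ : ∀ c, 0 < Θ.rhoP c) {a : ℝ}
    (hlt : ∀ x ∈ Set.Icc (0 : ℝ) 1, x < a → x < Θ.shareMap x)
    (hgt : ∀ x ∈ Set.Icc (0 : ℝ) 1, a < x → Θ.shareMap x < x) :
    ∀ᵐ ω ∂P, ∀ c, Tendsto (fun n : ℕ => sizeShare (N (n + 2) ω) c) atTop (𝓝 (share a c)) := by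
  filter_upwards [hN.ae_growth hρ, hN.ae_tendsto_sizeSum hρ hlt hgt] with ω hω hx c
  cases c
  · refine hx.congr fun n => ?_
    rw [sizeShare, (hω n).2.1]
    push_cast
    rfl
  · refine (hx.const_sub 1).congr fun n => ?_
    have h : ((N (n + 2) ω).sizeSum .red : ℝ) + (N (n + 2) ω).sizeSum .blue = n + 2 := by
      have := Color.sum_univ (N (n + 2) ω).sizeSum ▸ (hω n).1.sum_sizeSum
      rw [(hω n).2.1] at this
      exact_mod_cast this
    rw [sizeShare, (hω n).2.1]
    push_cast
    rw [eq_div_iff (by positivity), sub_mul, div_mul_cancel₀ _ (by positivity)]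
    linarith

theorem IsGSHM.ae_tendsto_gainRate (hN : IsGSHM Θ P N) (hρ : ∀ c, 0 < Θ.rhoP c) {a : ℝ}
    (ha : a ∈ Set.Icc (0 : ℝ) 1)
    (hlt : ∀ x ∈ Set.Icc (0 : ℝ) 1, x < a → x < Θ.shareMap x)
    (hgt : ∀ x ∈ Set.Icc (0 : ℝ) 1, a < x → Θ.shareMap x < x) (c : Color) (k : ℝ) :
    ∀ᵐ ω ∂P, Tendsto (fun n : ℕ => gainRate Θ c (memberProb Θ (N (n + 2) ω))
      (fun m => Θ.successProb m (sizeShare (N (n + 2) ω)) (groupShare (N (n + 2) ω)))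
      ((N (n + 2) ω).edges.length / (N (n + 2) ω).groups.length) k) atTop
      (𝓝 (k * Θ.C1 a c + Θ.C2 a c)) := by
  filter_upwards [hN.ae_growth hρ, ae_all_iff.2 (hN.ae_tendsto_memberProb hρ),
    hN.ae_tendsto_groups hρ, hN.ae_tendsto_sizeShare hρ hlt hgt] with ω hω hq hz hx
  rw [← gainRate_limit]
  have hs : Tendsto (fun n : ℕ => ((N (n + 2) ω).edges.length : ℝ) / (N (n + 2) ω).groups.length)
      atTop (𝓝 (1 / Θ.eta)) := hz.1.congr fun n => by rw [(hω n).2.1]; push_cast; rfl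
  unfold gainRate
  refine tendsto_finsetSum _ fun m _ => (hq m).mul (Tendsto.const_mul _ (Tendsto.div
    (tendsto_const_nhds.add (hs.const_mul _)) ?_ (Θ.successProb_share_pos hρ m ha).ne'))
  unfold Params.successProb
  exact ((tendsto_finsetSum _ fun c _ => (hx c).const_mul _).const_mul _).add
    ((tendsto_finsetSum _ fun c _ => (hz.2 c).const_mul _).const_mul _)

theorem IsGSHM.ae_tendsto_sizeCount (hN : IsGSHM Θ P N) (hρ : ∀ c, 0 < Θ.rhoP c) {a : ℝ}
    (ha : a ∈ Set.Icc (0 : ℝ) 1)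
    (hlt : ∀ x ∈ Set.Icc (0 : ℝ) 1, x < a → x < Θ.shareMap x)
    (hgt : ∀ x ∈ Set.Icc (0 : ℝ) 1, a < x → Θ.shareMap x < x) (c : Color) (k : ℕ) :
    ∀ᵐ ω ∂P, Tendsto (fun n : ℕ => ((N (n + 2) ω).sizeCount c k : ℝ) / (n + 2)) atTop
      (𝓝 (limitCount Θ a c k)) := by
  induction k with
  | zero =>
    filter_upwards [hN.ae_growth hρ] with ω hω
    refine tendsto_const_nhds.congr fun n => ?_
    simp [(hω n).1.sizeCount_zero, limitCount]
  | succ j ih =>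
    have hC1 := Θ.C1_nonneg hρ ha c
    have hC2 := Θ.C2_nonneg hρ ha c
    refine hN.ae_tendsto_div_of_linear hρ (Network.hasIncrements_sizeCount c (j + 1))
      (fun x => by positivity) (sizeCount_initial_le c _) (by positivity) ?_
    filter_upwards [ih, hN.ae_growth hρ, hN.ae_tendsto_memberProb hρ c,
      hN.ae_tendsto_gainRate hρ ha hlt hgt c j, hN.ae_tendsto_gainRate hρ ha hlt hgt c (j + 1 : ℕ),
      hN.ae_le hρ (Network.hasIncrements_sizeCount c (j + 1)) (sizeCount_initial_le c _)]
      with ω ih hω hq hr hr' hle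
    have h1 : Tendsto (fun n : ℕ => Θ.eta * (if j = 0 then memberProb Θ (N (n + 2) ω) c else 0))
        atTop (𝓝 (Θ.eta * if j = 0 then Θ.colorProb c else 0)) := by
      split_ifs
      · exact hq.const_mul _
      · exact tendsto_const_nhds
    -- the number of groups per time step is not known to converge yet, but it is bounded
    have h2 : Tendsto (fun n : ℕ => (((j + 1 : ℕ) * Θ.C1 a c + Θ.C2 a c) - gainRate Θ c
        (memberProb Θ (N (n + 2) ω))
        (fun m => Θ.successProb m (sizeShare (N (n + 2) ω)) (groupShare (N (n + 2) ω)))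
        ((N (n + 2) ω).edges.length / (N (n + 2) ω).groups.length) (j + 1 : ℕ))
          * ((N (n + 2) ω).sizeCount c (j + 1) / ((n : ℝ) + 2))) atTop (𝓝 0) := by
      refine Tendsto.zero_mul_isBoundedUnder_le ?_ ⟨1, ?_⟩
      · simpa using hr'.const_sub ((j + 1 : ℕ) * Θ.C1 a c + Θ.C2 a c)
      · refine eventually_map.2 (.of_forall fun n => ?_)
        simp only [Function.comp, Real.norm_eq_abs]
        rw [abs_of_nonneg (by positivity)]
        exact (div_le_one (by positivity)).2 (hle n)
    have h3 := ((h1.add (hr.mul ih)).sub_const (Θ.eta * (if j = 0 then Θ.colorProb c else 0)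
      + (j * Θ.C1 a c + Θ.C2 a c) * limitCount Θ a c j)).add h2
    rw [sub_self, add_zero] at h3
    refine h3.congr fun n => ?_
    rw [stepMean_sizeCount Θ (hω n).1, (hω n).2.1]
    push_cast
    ring

theorem IsGSHM.tendsto_integral_sizeCount (hN : IsGSHM Θ P N) (hρ : ∀ c, 0 < Θ.rhoP c) {a : ℝ}
    (ha : a ∈ Set.Icc (0 : ℝ) 1)
    (hlt : ∀ x ∈ Set.Icc (0 : ℝ) 1, x < a → x < Θ.shareMap x)
    (hgt : ∀ x ∈ Set.Icc (0 : ℝ) 1, a < x → Θ.shareMap x < x) (c : Color) (k : ℕ) :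
    Tendsto (fun t : ℕ => (∫ ω, ((N t ω).sizeCount c k : ℝ) ∂P) / (t : ℝ)) atTop
      (𝓝 (limitCount Θ a c k)) := by
  rw [← tendsto_add_atTop_iff_nat 2]
  have hlim := tendsto_integral_of_dominated_convergence (μ := P) (fun _ => (1 : ℝ))
    (F := fun n ω => ((N (n + 2) ω).sizeCount c k : ℝ) / ((n : ℝ) + 2))
    (f := fun _ => limitCount Θ a c k)
    (fun n => ((Measurable.of_discrete (f := fun x : Network => (x.sizeCount c k : ℝ) /
      ((n : ℝ) + 2))).comp (hN.measurable (n + 2) (by omega))).aestronglyMeasurable)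
    (integrable_const _) (fun n => by
      filter_upwards [hN.ae_le hρ (Network.hasIncrements_sizeCount c k)
        (sizeCount_initial_le c k)] with ω hω
      rw [Real.norm_eq_abs, abs_of_nonneg (by positivity)]
      exact (div_le_one (by positivity)).2 (hω n))
    (hN.ae_tendsto_sizeCount hρ ha hlt hgt c k)
  simp only [integral_const, probReal_univ, one_smul] at hlim
  refine hlim.congr fun n => ?_
  rw [integral_div]
  push_cast
  rfl

end Chain

end GSHM

theorem theorem5p1 (Θ : GSHM.Params)
    (hR : 0 < Θ.rhoP GSHM.Color.red) (hB : 0 < Θ.rhoP GSHM.Color.blue)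
    {Ω : Type*} [MeasurableSpace Ω] (P : Measure Ω) [IsProbabilityMeasure P]
    (N : ℕ → Ω → GSHM.Network) (hN : GSHM.IsGSHM Θ P N) :
    ∃ a : ℝ,
      -- `a` is the unique fixed point in the open unit interval
      (a ∈ Set.Ioo (0 : ℝ) 1 ∧ Θ.shareMap a = a ∧
        ∀ x ∈ Set.Ioo (0 : ℝ) 1, Θ.shareMap x = x → x = a) ∧
      -- `a` is the limiting share of the red groups in the total of the group sizes
      (∀ᵐ ω ∂P, Tendsto
        (fun t => ((N t ω).sizeSum GSHM.Color.red : ℝ) /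
          (((N t ω).sizeSum GSHM.Color.red : ℝ) + ((N t ω).sizeSum GSHM.Color.blue : ℝ)))
        atTop (𝓝 a)) ∧
      -- the limiting expected group-size distributions exist, ...
      ∃ G : GSHM.Color → ℕ → ℝ,
        (∀ c k, 1 ≤ k →
          Tendsto (fun t : ℕ => (∫ ω, ((N t ω).sizeCount c k : ℝ) ∂P) / (t : ℝ))
            atTop (𝓝 (G c k))) ∧
        -- ... satisfy the recursions, ...
        (∀ c, G c 1 = Θ.colorProb c * Θ.eta / (1 + Θ.C1 a c + Θ.C2 a c)) ∧
        (∀ c k, 2 ≤ k → G c k =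
          G c (k - 1) * ((((k : ℝ) - 1) * Θ.C1 a c + Θ.C2 a c) /
            (1 + (k : ℝ) * Θ.C1 a c + Θ.C2 a c))) ∧
        -- ... and follow power laws, provided that the rich-get-richer mechanism is present
        (0 < Θ.xi → ∀ c, 0 < Θ.C1 a c ∧ ∃ A : ℝ, 0 < A ∧
          (fun k : ℕ => G c k) ~[atTop] (fun k : ℕ => A * (k : ℝ) ^ (-Θ.beta a c))) := by
  have hρ : ∀ c, 0 < Θ.rhoP c := fun c => by cases c <;> assumption
  obtain ⟨a, ha, hfix, hlt, hgt⟩ := Θ.exists_shareMap_fixedPoint hρ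
  have ha' : a ∈ Set.Icc (0 : ℝ) 1 := ⟨ha.1.le, ha.2.le⟩
  have hone : ∀ c, GSHM.limitCount Θ a c 1
      = Θ.colorProb c * Θ.eta / (1 + Θ.C1 a c + Θ.C2 a c) := fun c => by
    simp only [GSHM.limitCount, if_true]
    push_cast
    congr 1 <;> ring
  have hrec : ∀ c (k : ℕ), 2 ≤ k → GSHM.limitCount Θ a c k = GSHM.limitCount Θ a c (k - 1) *
      ((((k : ℝ) - 1) * Θ.C1 a c + Θ.C2 a c) / (1 + (k : ℝ) * Θ.C1 a c + Θ.C2 a c)) := by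
    intro c k hk
    obtain ⟨j, rfl⟩ : ∃ j, k = j + 1 := ⟨k - 1, by omega⟩
    rw [GSHM.limitCount, if_neg (by omega), Nat.add_sub_cancel]
    push_cast
    rw [add_sub_cancel_right, mul_zero, zero_add, ← add_assoc]
    ring
  refine ⟨a, ⟨ha, hfix, fun x hx hfx => Θ.shareMap_fixedPoint_unique hρ hx ha hfx hfix⟩, ?_,
    GSHM.limitCount Θ a, fun c k _ => hN.tendsto_integral_sizeCount hρ ha' hlt hgt c k, hone, hrec,
    fun hxi c => ⟨Θ.C1_pos hρ hxi ha' c, ?_⟩⟩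
  · filter_upwards [hN.ae_growth hρ, hN.ae_tendsto_sizeShare hρ hlt hgt] with ω hω h
    rw [← tendsto_add_atTop_iff_nat 2]
    refine (h .red).congr fun n => ?_
    rw [GSHM.sizeShare, ← (hω n).1.sum_sizeSum, GSHM.Color.sum_univ]
    push_cast
    rfl
  · have hC1 := Θ.C1_pos hρ hxi ha' c
    have hC2 := Θ.C2_nonneg hρ ha' c
    have hη := Θ.eta_pos
    have hc := Θ.colorProb_pos c
    exact GSHM.exists_isEquivalent_rpow_of_recursion hC1 hC2
      (by rw [hone]; positivity) (hrec c)
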